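/- **Theorem (Time-discrete energy stability).** Let $d\ge 1$ and let $\Omega\subset\mathbb R^d$ be a bounded open set whose boundary is locally a Lipschitz graph, except possibly at a closed set of vanishing $(d-1)$-dimensional Hausdorff measure (for instance a bounded Lipschitz domain or a polyhedral domain). Let $\tilde f=\tilde f(\rho,\varphi)$ be a real function, let $\mathbf S=\mathbf S(\varphi,\mathbf A)\in\mathbb R^{d\times d}$ ($\varphi\in\mathbb R$, $\mathbf A\in\mathbb R^{d\times d}$) be continuous, let $\gamma,\eta\in\mathbb R$, and let $0=t_0<t_1<\dots<t_N$, $\Delta t_n=t_{n+1}-t_n$. For iterates write $\Phi^{n+\frac12}=\tfrac12(\Phi^{n+1}+\Phi^n)$. Let $(\rho^n,\mathbf v^n,\varphi^n,\mu^n,\tau^n,\boldsymbol\sigma^n)$, $0\le n\le N$, be of class $C^1(\bar\Omega)$ with values in $\mathbb R\times\mathbb R^d\times\mathbb R\times\mathbb R\times\mathbb R\times\mathbb R^d$, with $\rho^n>0$ in $\Omega$, with $\mathbf v^n=0$ on $\partial\Omega$ and $\boldsymbol\sigma^n\cdot\mathbf n=0$ at every boundary point that has an outward unit normal $\mathbf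 n$, with $\boldsymbol\sigma^0=\nabla\varphi^0$ in $\Omega$, and such that for $n=0,\dots,N-1$ the following equations hold in $\Omega$: $$\begin{aligned} 0&=\frac{\rho^{n+1}-\rho^n}{\Delta t_n}+\operatorname{div}(\rho^{n+\frac12}\mathbf v^{n+\frac12}),\\ 0&=\rho^{n+\frac12}\,\frac{\mathbf v^{n+1}-\mathbf v^n}{\Delta t_n}+\operatorname{div}(\rho^{n+\frac12}\mathbf v^{n+\frac12}\otimes\mathbf v^{n+\frac12})-\operatorname{div}(\rho^{n+\frac12}\mathbf v^{n+\frac12})\mathbf v^{n+\frac12}-\tfrac12\rho^{n+\frac12}\nabla|\mathbf v^{n+\frac12}|^2\\ &\quad+\rho^{n+\frac12}\nabla\tau^{n+\frac12}-\mu^{n+\frac12}\nabla\varphi^{n+\frac12}-\operatorname{div}\mathbf S(\varphi^{n+\frac12},\nabla\mathbf v^{n+\frac12}),\\ 0&=\frac{\varphi^{n+1}-\varphi^n}{\Delta t_n}+\nabla\varphi^{n+\frac12}\cdot\mathbf v^{n+\frac12}+\eta\,\frac{\mu^{n+\frac12}}{\rho^{n+\frac12}},\\ 0&=\mu^{n+\frac12}-\frac{\rho^{n+1}\tilde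 f(\rho^{n+1},\varphi^{n+1})-\rho^{n+1}\tilde f(\rho^{n+1},\varphi^n)+\rho^n\tilde f(\rho^n,\varphi^{n+1})-\rho^n\tilde f(\rho^n,\varphi^n)}{2(\varphi^{n+1}-\varphi^n)}+\gamma\operatorname{div}\boldsymbol\sigma^{n+\frac12},\\ 0&=\tau^{n+\frac12}-\frac{\rho^{n+1}\tilde f(\rho^{n+1},\varphi^{n+1})-\rho^n\tilde f(\rho^n,\varphi^{n+1})+\rho^{n+1}\tilde f(\rho^{n+1},\varphi^n)-\rho^n\tilde f(\rho^n,\varphi^n)}{2(\rho^{n+1}-\rho^n)}-\tfrac14\left(|\mathbf v^{n+1}|^2+|\mathbf v^n|^2\right),\\ 0&=\boldsymbol\sigma^{n+1}-\nabla\varphi^{n+1}. \end{aligned}$$ Here matrix divergences are taken row-wise and $(\nabla\mathbf v)_{ij}=\partial_jv_i$; $\operatorname{div}\mathbf S$ is the weak divergence, and the second equation is required almost everywhere; the fourth (fifth) equation is required only at the points where $\varphi^{n+1}\ne\varphi^n$ ($\rho^{n+1}\neq\rho^n$), so that any convention for the difference quotient is allowed elsewhere. Suppose that $\rho^0\tilde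 f(\rho^0,\varphi^0)$ is integrable over $\Omega$. Then for every $n\in\{0,\dots,N\}$ all integrands below are integrable over $\Omega$ and $$\begin{aligned} &\int_\Omega\rho^n\tilde f(\rho^n,\varphi^n)+\tfrac12\rho^n|\mathbf v^n|^2+\tfrac\gamma2|\boldsymbol\sigma^n|^2\,d\mathbf x =\int_\Omega\rho^0\tilde f(\rho^0,\varphi^0)+\tfrac12\rho^0|\mathbf v^0|^2+\tfrac\gamma2|\boldsymbol\sigma^0|^2\,d\mathbf x\\ &\qquad-\sum_{j=0}^{n-1}\Delta t_j\int_\Omega\mathbf S(\varphi^{j+\frac12},\nabla\mathbf v^{j+\frac12}):\nabla\mathbf v^{j+\frac12}+\eta\,\frac{|\mu^{j+\frac12}|^2}{\rho^{j+\frac12}}\,d\mathbf x. \end{aligned}$$ -/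

import Mathlib

open MeasureTheory
open scoped ContDiff

namespace NSAC

/-- The space `ℝ^d` with the Euclidean norm. -/
abbrev E (d : ℕ) : Type := EuclideanSpace ℝ (Fin d)

noncomputable section

/-! ### Differential operators -/

/-- The `j`-th partial derivative of a scalar function. -/
def pderiv {d : ℕ} (j : Fin d) (u : E d → ℝ) (x : E d) : ℝ :=
  fderiv ℝ u x (EuclideanSpace.single j 1)

/-- The divergence `∑ⱼ ∂ⱼ uⱼ` of a vector field. -/
def divergence {d : ℕ} (u : E d → E d) (x : E d) : ℝ :=
  ∑ j, pderiv j (fun y => u y j) x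

/-- The row-wise divergence `(∑ⱼ ∂ⱼ Mᵢⱼ)ᵢ` of a matrix field. -/
def tensorDivergence {d : ℕ} (M : E d → Matrix (Fin d) (Fin d) ℝ) (x : E d) : E d :=
  WithLp.toLp 2 fun i => ∑ j, pderiv j (fun y => M y i j) x

/-- The Jacobian matrix `(∂ⱼ vᵢ)ᵢⱼ` of a vector field. -/
def jacobian {d : ℕ} (v : E d → E d) (x : E d) : Matrix (Fin d) (Fin d) ℝ :=
  Matrix.of fun i j => pderiv j (fun y => v y i) x

/-- The tensor product `(aᵢ bⱼ)ᵢⱼ` of two vectors. -/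
def tensor {d : ℕ} (a b : E d) : Matrix (Fin d) (Fin d) ℝ :=
  Matrix.of fun i j => a i * b j

/-- The Frobenius product `A : B = ∑ᵢⱼ Aᵢⱼ Bᵢⱼ`. -/
def frob {d : ℕ} (A B : Matrix (Fin d) (Fin d) ℝ) : ℝ :=
  ∑ i, ∑ j, A i j * B i j

/-- `D` is the weak (distributional) row-wise divergence of the matrix field `M` in `Ω`:
`∫ D · X = - ∫ M : ∇X` for every smooth vector field `X` with compact support in `Ω`. -/
structure IsWeakTensorDivergence {d : ℕ} (Ω : Set (E d))
    (M : E d → Matrix (Fin d) (Fin d) ℝ) (D : E d → E d) : Prop where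
  locallyIntegrable_field : ∀ i j, LocallyIntegrableOn (fun x => M x i j) Ω
  locallyIntegrable_div : LocallyIntegrableOn D Ω
  integral_eq : ∀ X : E d → E d, ContDiff ℝ ∞ X → HasCompactSupport X → tsupport X ⊆ Ω →
    ∫ x in Ω, inner ℝ (D x) (X x) = - ∫ x in Ω, frob (M x) (jacobian X x)

/-- `u` belongs to `C¹(closure Ω)`: it is continuous on `closure Ω` and differentiable in `Ω`,
and its derivative extends continuously to `closure Ω`. Only the values of `u` on `closure Ω`
matter. -/
def IsC1Closure {d : ℕ} {F : Type} [NormedAddCommGroup F] [NormedSpace ℝ F]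
    (Ω : Set (E d)) (u : E d → F) : Prop :=
  ContinuousOn u (closure Ω) ∧ DifferentiableOn ℝ u Ω ∧
    ∃ G : E d → (E d →L[ℝ] F), ContinuousOn G (closure Ω) ∧ ∀ x ∈ Ω, G x = fderiv ℝ u x

/-! ### The spatial domain -/

/-- In a neighbourhood of `p`, the set `Ω` is, for some unit vector `e`, the set of points below
the graph (over the hyperplane orthogonal to `e`) of a Lipschitz function. The function is written
as a function on `ℝ^d` that is invariant in the direction `e`. -/
def IsLipschitzBoundaryPoint {d : ℕ} (Ω : Set (E d)) (p : E d) : Prop :=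
  ∃ (e : E d) (g : E d → ℝ) (K : NNReal) (r : ℝ),
    ‖e‖ = 1 ∧ LipschitzWith K g ∧ (∀ (x : E d) (s : ℝ), g (x + s • e) = g x) ∧ 0 < r ∧
      ∀ x ∈ Metric.ball p r, x ∈ Ω ↔ inner ℝ x e < g x

/-- The admissible domains: bounded open sets whose boundary is locally a Lipschitz graph, with the
possible exception of a closed set of vanishing `(d-1)`-dimensional Hausdorff measure (the vertices
and edges of a polyhedral domain, for instance). Bounded Lipschitz domains and polyhedral domains
are of this kind. -/
structure IsAdmissibleDomain {d : ℕ} (Ω : Set (E d)) : Prop where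
  isOpen : IsOpen Ω
  isBounded : Bornology.IsBounded Ω
  regular : ∃ Z : Set (E d), IsClosed Z ∧ Measure.hausdorffMeasure ((d : ℝ) - 1) Z = 0 ∧
    ∀ p ∈ frontier Ω \ Z, IsLipschitzBoundaryPoint Ω p

/-- `n` is the outward unit normal of `Ω` at `x`: seen from `x`, the set `Ω` is asymptotically the
half-space of the directions that have a negative component along `n`. -/
def IsOutwardNormal {d : ℕ} (Ω : Set (E d)) (x n : E d) : Prop :=
  ‖n‖ = 1 ∧ ∀ ε > 0, ∃ δ > 0, ∀ y ∈ Metric.ball x δ,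
    (inner ℝ (y - x) n < -(ε * ‖y - x‖) → y ∈ Ω) ∧
    (ε * ‖y - x‖ < inner ℝ (y - x) n → y ∉ Ω)

/-! ### The time discretization -/

/-- The six unknowns at one time: density `ρ`, velocity `v`, phase field `φ`, generalized chemical
potential `μ`, auxiliary variable `τ`, and auxiliary variable `σ` (the gradient of `φ`). -/
structure Fields (d : ℕ) where
  ρ : E d → ℝ
  v : E d → E d
  φ : E d → ℝ
  μ : E d → ℝ
  τ : E d → ℝ
  σ : E d → E d

/-- The arithmetic mean of two iterates; `mid (U n) (U (n+1))` is the value at level `n + 1/2`. -/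
def Fields.mid {d : ℕ} (U V : Fields d) : Fields d where
  ρ := fun x => (V.ρ x + U.ρ x) / 2
  v := fun x => (1 / 2 : ℝ) • (V.v x + U.v x)
  φ := fun x => (V.φ x + U.φ x) / 2
  μ := fun x => (V.μ x + U.μ x) / 2
  τ := fun x => (V.τ x + U.τ x) / 2
  σ := fun x => (1 / 2 : ℝ) • (V.σ x + U.σ x)

/-- The iterates are of class `C¹(closure Ω)` and satisfy the boundary conditions `v = 0` and
`σ · n = 0` on the boundary of `Ω` (the latter wherever the outward normal exists), and the density
is positive. -/
structure Fields.IsAdmissible {d : ℕ} (Ω : Set (E d)) (U : Fields d) : Prop where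
  c1_ρ : IsC1Closure Ω U.ρ
  c1_v : IsC1Closure Ω U.v
  c1_φ : IsC1Closure Ω U.φ
  c1_μ : IsC1Closure Ω U.μ
  c1_τ : IsC1Closure Ω U.τ
  c1_σ : IsC1Closure Ω U.σ
  ρ_pos : ∀ x ∈ Ω, 0 < U.ρ x
  v_boundary : ∀ x ∈ frontier Ω, U.v x = 0
  σ_boundary : ∀ x ∈ frontier Ω, ∀ n, IsOutwardNormal Ω x n → inner ℝ (U.σ x) n = 0

/-- The equations of one time step of length `Δt`, from the iterate `U` to the iterate `V`, with
`W = mid U V`. Here `f ρ φ` is the mixture free energy, `S φ (∇v)` the viscous stress, `γ` the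
capillarity constant and `η` the mobility. The divergence of the stress involves second
derivatives of `v`, which is only `C¹`; it is the weak divergence. Each of the two difference
quotients of `ρ f(ρ, φ)` is prescribed at the points where its denominator does not vanish; nothing
is required at the other points, so that every convention for the quotient there is covered. -/
structure IsTimeStep {d : ℕ} (Ω : Set (E d)) (f : ℝ → ℝ → ℝ)
    (S : ℝ → Matrix (Fin d) (Fin d) ℝ → Matrix (Fin d) (Fin d) ℝ) (γ η Δt : ℝ)
    (U V W : Fields d) : Prop where
  mass : ∀ x ∈ Ω,
    0 = (V.ρ x - U.ρ x) / Δt + divergence (fun y => W.ρ y • W.v y) x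
  momentum : ∃ divS : E d → E d,
    IsWeakTensorDivergence Ω (fun y => S (W.φ y) (jacobian W.v y)) divS ∧
    ∀ᵐ x ∂(volume.restrict Ω),
      0 = W.ρ x • ((1 / Δt) • (V.v x - U.v x))
        + tensorDivergence (fun y => W.ρ y • tensor (W.v y) (W.v y)) x
        - divergence (fun y => W.ρ y • W.v y) x • W.v x
        - (1 / 2 * W.ρ x) • gradient (fun y => ‖W.v y‖ ^ 2) x
        + W.ρ x • gradient W.τ x
        - W.μ x • gradient W.φ x
        - divS x
  phase : ∀ x ∈ Ω,
    0 = (V.φ x - U.φ x) / Δt + inner ℝ (gradient W.φ x) (W.v x) + η * (W.μ x / W.ρ x)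
  potential : ∀ x ∈ Ω, V.φ x ≠ U.φ x →
    0 = W.μ x
      - (V.ρ x * f (V.ρ x) (V.φ x) - V.ρ x * f (V.ρ x) (U.φ x)
          + U.ρ x * f (U.ρ x) (V.φ x) - U.ρ x * f (U.ρ x) (U.φ x))
        / (2 * (V.φ x - U.φ x))
      + γ * divergence W.σ x
  auxiliary : ∀ x ∈ Ω, V.ρ x ≠ U.ρ x →
    0 = W.τ x
      - (V.ρ x * f (V.ρ x) (V.φ x) - U.ρ x * f (U.ρ x) (V.φ x)
          + V.ρ x * f (V.ρ x) (U.φ x) - U.ρ x * f (U.ρ x) (U.φ x))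
        / (2 * (V.ρ x - U.ρ x))
      - 1 / 4 * (‖V.v x‖ ^ 2 + ‖U.v x‖ ^ 2)
  gradient_eq : ∀ x ∈ Ω, 0 = V.σ x - gradient V.φ x

/-- `U 0, …, U N` are the iterates of a time-discrete solution for the time levels
`0 = t 0 < t 1 < … < t N`. The initial value of `σ` is the gradient of the initial phase field. -/
structure IsTimeDiscreteSolution {d : ℕ} (Ω : Set (E d)) (f : ℝ → ℝ → ℝ)
    (S : ℝ → Matrix (Fin d) (Fin d) ℝ → Matrix (Fin d) (Fin d) ℝ) (γ η : ℝ)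
    (N : ℕ) (t : ℕ → ℝ) (U : ℕ → Fields d) : Prop where
  time_zero : t 0 = 0
  time_lt : ∀ n < N, t n < t (n + 1)
  admissible : ∀ n ≤ N, (U n).IsAdmissible Ω
  initial_σ : ∀ x ∈ Ω, (U 0).σ x = gradient (U 0).φ x
  step : ∀ n < N,
    IsTimeStep Ω f S γ η (t (n + 1) - t n) (U n) (U (n + 1)) ((U n).mid (U (n + 1)))

/-- The energy density `ρ f(ρ, φ) + ½ ρ |v|² + (γ/2) |σ|²`. -/
def energyDensity {d : ℕ} (f : ℝ → ℝ → ℝ) (γ : ℝ) (U : Fields d) (x : E d) : ℝ :=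
  U.ρ x * f (U.ρ x) (U.φ x) + 1 / 2 * U.ρ x * ‖U.v x‖ ^ 2 + γ / 2 * ‖U.σ x‖ ^ 2

/-- The dissipation density `S(φ, ∇v) : ∇v + η |μ|² / ρ`. -/
def dissipationDensity {d : ℕ}
    (S : ℝ → Matrix (Fin d) (Fin d) ℝ → Matrix (Fin d) (Fin d) ℝ) (η : ℝ)
    (U : Fields d) (x : E d) : ℝ :=
  frob (S (U.φ x) (jacobian U.v x)) (jacobian U.v x) + η * (|U.μ x| ^ 2 / U.ρ x)

end

end NSAC

/-! The scheme is built so that the energy increment over one step is, pointwise, a sum of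
divergences and dissipation. The increments of `φ` and `ρ` times their difference quotients add up
exactly to the increment of `ρ f(ρ, φ)`. The kinetic increment splits into the midpoint density
times the increment of `|v|² / 2`, plus the density increment times `(|v|² + |v'|²) / 4`, where `v`
and `v'` are the old and new velocities; the second part cancels the quarter term in the equation
for `τ`. The first part comes from testing the momentum equation with the midpoint velocity, where
the convective terms cancel. The mass equation tested with `τ` and the phase equation tested with
`μ` remove the remaining increments. What is left is `γ div(δφ σ)`, `-Δt div(τ ρ v)`, `-Δt η |μ|² /
ρ` and `Δt D · v`, with `δφ` the increment of `φ` and `D` the weak divergence of the stress.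

Integrating this identity requires two analytic facts. The first is the divergence theorem for a
`C¹` field with zero normal component (`IsAdmissibleDomain.integral_divergence_eq_zero`). It is
proved by cutoffs, without surface measure. Near a Lipschitz boundary point the cutoff gradient has
size `m` on a layer of volume `O(1/m)`, and there it is almost orthogonal to the field, because the
graph has the same gradient at the point and at its projection along the graph direction. The
exceptional set is removed by cutoffs on balls with small `∑ r ^ (d - 1)`, which bounds the error.

The second is that the weak divergence may be tested with the velocity, which is only `C¹` and
vanishes on the boundary (`IsWeakTensorDivergence.integral_eq_of_frontier_eq_zero`). The velocity is
truncated where its own values are small, so no boundary regularity is involved.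

Integrability is mostly that of functions with a continuous extension to the compact closure. No
regularity of `f` is available, so integrability of `ρ f(ρ, φ)` is passed from one step to the next:
its increment is a combination of the `C¹` unknowns. -/

namespace NSAC

open Set Filter Topology

/-! ### Functions with a continuous extension to the closure -/

/-- `u` agrees in `Ω` with a function that is continuous on `closure Ω`. -/
def HasContExt {d : ℕ} {F : Type} [TopologicalSpace F] (Ω : Set (E d)) (u : E d → F) : Prop :=
  ∃ g : E d → F, ContinuousOn g (closure Ω) ∧ EqOn u g Ω

section HasContExt

variable {d : ℕ} {Ω : Set (E d)} {F G H : Type}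

lemma _root_.ContinuousOn.hasContExt [TopologicalSpace F] {u : E d → F}
    (hu : ContinuousOn u (closure Ω)) : HasContExt Ω u := ⟨u, hu, fun _ _ => rfl⟩

lemma HasContExt.const [TopologicalSpace F] (c : F) : HasContExt Ω (fun _ => c) :=
  continuousOn_const.hasContExt

lemma HasContExt.congr [TopologicalSpace F] {u v : E d → F} (hu : HasContExt Ω u)
    (h : EqOn v u Ω) : HasContExt Ω v := by
  obtain ⟨g, hg, hug⟩ := hu
  exact ⟨g, hg, h.trans hug⟩

lemma HasContExt.continuousOn [TopologicalSpace F] {u : E d → F} (hu : HasContExt Ω u) :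
    ContinuousOn u Ω := by
  obtain ⟨g, hg, hug⟩ := hu
  exact (hg.mono subset_closure).congr hug

lemma HasContExt.comp [TopologicalSpace F] [TopologicalSpace G] {u : E d → F} {Φ : F → G}
    (hΦ : Continuous Φ) (hu : HasContExt Ω u) : HasContExt Ω (fun x => Φ (u x)) := by
  obtain ⟨g, hg, hug⟩ := hu
  exact ⟨fun x => Φ (g x), hΦ.comp_continuousOn hg, fun x hx => by simp only [hug hx]⟩

lemma HasContExt.comp₂ [TopologicalSpace F] [TopologicalSpace G] [TopologicalSpace H]
    {u : E d → F} {v : E d → G} {Φ : F × G → H} (hΦ : Continuous Φ)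
    (hu : HasContExt Ω u) (hv : HasContExt Ω v) : HasContExt Ω (fun x => Φ (u x, v x)) := by
  obtain ⟨g, hg, hug⟩ := hu
  obtain ⟨k, hk, hvk⟩ := hv
  exact ⟨fun x => Φ (g x, k x), hΦ.comp_continuousOn (hg.prodMk hk),
    fun x hx => by simp only [hug hx, hvk hx]⟩

lemma HasContExt.pi {ι : Type} [TopologicalSpace F] {u : E d → ι → F}
    (hu : ∀ i, HasContExt Ω (fun x => u x i)) : HasContExt Ω u := by
  choose g hg hug using hu
  exact ⟨fun x i => g i x, continuousOn_pi.2 hg, fun x hx => funext fun i => hug i hx⟩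

variable [NormedAddCommGroup F] [NormedAddCommGroup G]

lemma HasContExt.add {u v : E d → F} (hu : HasContExt Ω u) (hv : HasContExt Ω v) :
    HasContExt Ω (fun x => u x + v x) := hu.comp₂ continuous_add hv

lemma HasContExt.sub {u v : E d → F} (hu : HasContExt Ω u) (hv : HasContExt Ω v) :
    HasContExt Ω (fun x => u x - v x) := hu.comp₂ continuous_sub hv

lemma HasContExt.smul [NormedSpace ℝ F] {u : E d → ℝ} {v : E d → F}
    (hu : HasContExt Ω u) (hv : HasContExt Ω v) : HasContExt Ω (fun x => u x • v x) := hu.comp₂ continuous_smul hv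

lemma HasContExt.mul {u v : E d → ℝ} (hu : HasContExt Ω u) (hv : HasContExt Ω v) :
    HasContExt Ω (fun x => u x * v x) := hu.comp₂ continuous_mul hv

lemma HasContExt.const_mul {u : E d → ℝ} (c : ℝ) (hu : HasContExt Ω u) :
    HasContExt Ω (fun x => c * u x) := (HasContExt.const c).mul hu

lemma HasContExt.const_smul [NormedSpace ℝ F] {u : E d → F} (c : ℝ) (hu : HasContExt Ω u) :
    HasContExt Ω (fun x => c • u x) := (HasContExt.const c).smul hu

lemma HasContExt.div_const {u : E d → ℝ} (hu : HasContExt Ω u) (c : ℝ) :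
    HasContExt Ω (fun x => u x / c) := hu.comp (continuous_id.div_const c)

lemma HasContExt.inner {u v : E d → E d} (hu : HasContExt Ω u) (hv : HasContExt Ω v) :
    HasContExt Ω (fun x => inner ℝ (u x) (v x)) := hu.comp₂ continuous_inner hv

lemma HasContExt.norm_sq {u : E d → F} (hu : HasContExt Ω u) :
    HasContExt Ω (fun x => ‖u x‖ ^ 2) := hu.comp (continuous_norm.pow 2)

lemma HasContExt.clm_apply [NormedSpace ℝ F] [NormedSpace ℝ G] {A : E d → F →L[ℝ] G}
    {v : E d → F} (hA : HasContExt Ω A) (hv : HasContExt Ω v) : HasContExt Ω (fun x => A x (v x)) :=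
  hA.comp₂ (Φ := fun p : (F →L[ℝ] G) × F => p.1 p.2) isBoundedBilinearMap_apply.continuous hv

lemma HasContExt.sum {ι : Type} (s : Finset ι) {u : ι → E d → F}
    (hu : ∀ i, HasContExt Ω (u i)) : HasContExt Ω (fun x => ∑ i ∈ s, u i x) := by
  exact (HasContExt.pi hu (u := fun x i => u i x)).comp
    (continuous_finsetSum s fun i _ => continuous_apply i)

lemma HasContExt.exists_bound {u : E d → F} (hΩ : Bornology.IsBounded Ω) (hu : HasContExt Ω u) :
    ∃ C, 0 ≤ C ∧ ∀ x ∈ Ω, ‖u x‖ ≤ C := by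
  obtain ⟨g, hg, hug⟩ := hu
  obtain ⟨C, hC⟩ := hΩ.isCompact_closure.exists_bound_of_continuousOn hg
  exact ⟨max C 0, le_max_right _ _, fun x hx => by
    rw [hug hx]; exact (hC x (subset_closure hx)).trans (le_max_left _ _)⟩

lemma HasContExt.integrableOn {u : E d → F} (ho : IsOpen Ω) (hΩ : Bornology.IsBounded Ω)
    (hu : HasContExt Ω u) : IntegrableOn u Ω := by
  obtain ⟨g, hg, hug⟩ := hu
  exact ((hg.integrableOn_compact hΩ.isCompact_closure).mono_set subset_closure).congr_fun
    hug.symm ho.measurableSet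

end HasContExt

/-! ### Functions of class `C¹` up to the boundary -/

section IsC1Closure

variable {d : ℕ} {Ω : Set (E d)} {F : Type}
  [NormedAddCommGroup F] [NormedSpace ℝ F]

lemma IsC1Closure.hasContExt {u : E d → F} (hu : IsC1Closure Ω u) : HasContExt Ω u :=
  hu.1.hasContExt

lemma IsC1Closure.hasContExt_fderiv {u : E d → F} (hu : IsC1Closure Ω u) :
    HasContExt Ω (fderiv ℝ u) := by
  obtain ⟨K, hK, hKu⟩ := hu.2.2
  exact ⟨K, hK, fun x hx => (hKu x hx).symm⟩

lemma IsC1Closure.differentiableAt {u : E d → F} (ho : IsOpen Ω) (hu : IsC1Closure Ω u)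
    {x : E d} (hx : x ∈ Ω) : DifferentiableAt ℝ u x :=
  hu.2.1.differentiableAt (ho.mem_nhds hx)

lemma IsC1Closure.hasFDerivAt {u : E d → F} (ho : IsOpen Ω) (hu : IsC1Closure Ω u)
    {x : E d} (hx : x ∈ Ω) : HasFDerivAt u (fderiv ℝ u x) x :=
  (hu.differentiableAt ho hx).hasFDerivAt

lemma IsC1Closure.contDiffOn {u : E d → F} (ho : IsOpen Ω) (hu : IsC1Closure Ω u) :
    ContDiffOn ℝ 1 u Ω := by
  rw [show (1 : WithTop ℕ∞) = 0 + 1 from rfl, contDiffOn_succ_iff_fderiv_of_isOpen ho]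
  refine ⟨hu.2.1, by simp, ?_⟩
  rw [contDiffOn_zero]
  exact hu.hasContExt_fderiv.continuousOn

lemma IsC1Closure.of_hasFDerivAt {u : E d → F} {u' : E d → E d →L[ℝ] F}
    (hc : ContinuousOn u (closure Ω)) (hu : ∀ x ∈ Ω, HasFDerivAt u (u' x) x)
    (hu' : HasContExt Ω u') : IsC1Closure Ω u := by
  refine ⟨hc, fun x hx => (hu x hx).differentiableAt.differentiableWithinAt, ?_⟩
  obtain ⟨g, hg, hug⟩ := hu'
  exact ⟨g, hg, fun x hx => by rw [(hu x hx).fderiv, hug hx]⟩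

lemma IsC1Closure.add {u v : E d → F} (ho : IsOpen Ω) (hu : IsC1Closure Ω u)
    (hv : IsC1Closure Ω v) : IsC1Closure Ω (fun x => u x + v x) :=
  .of_hasFDerivAt (hu.1.add hv.1)
    (fun _ hx => (hu.hasFDerivAt ho hx).add (hv.hasFDerivAt ho hx))
    (hu.hasContExt_fderiv.add hv.hasContExt_fderiv)

lemma IsC1Closure.sub {u v : E d → F} (ho : IsOpen Ω) (hu : IsC1Closure Ω u)
    (hv : IsC1Closure Ω v) : IsC1Closure Ω (fun x => u x - v x) :=
  .of_hasFDerivAt (hu.1.sub hv.1)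
    (fun _ hx => (hu.hasFDerivAt ho hx).sub (hv.hasFDerivAt ho hx))
    (hu.hasContExt_fderiv.sub hv.hasContExt_fderiv)

lemma IsC1Closure.const_smul {u : E d → F} (ho : IsOpen Ω) (c : ℝ) (hu : IsC1Closure Ω u) :
    IsC1Closure Ω (fun x => c • u x) :=
  .of_hasFDerivAt (hu.1.const_smul c) (fun _ hx => (hu.hasFDerivAt ho hx).const_smul c)
    (hu.hasContExt_fderiv.const_smul c)

lemma IsC1Closure.smul {u : E d → ℝ} {v : E d → F} (ho : IsOpen Ω) (hu : IsC1Closure Ω u)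
    (hv : IsC1Closure Ω v) : IsC1Closure Ω (fun x => u x • v x) :=
  .of_hasFDerivAt (hu.1.smul hv.1)
    (fun _ hx => (hu.hasFDerivAt ho hx).smul (hv.hasFDerivAt ho hx))
    ((hu.hasContExt.smul hv.hasContExt_fderiv).add
      (hu.hasContExt_fderiv.comp₂
        (Φ := fun p : (E d →L[ℝ] ℝ) × F => p.1.smulRight p.2)
        (ContinuousLinearMap.smulRightL ℝ (E d) F).continuous₂ hv.hasContExt))

end IsC1Closure

/-! ### The differential operators in terms of the Fréchet derivative -/

section Operators

variable {d : ℕ} {Ω : Set (E d)}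

lemma pderiv_apply {u : E d → E d} {x : E d} (hu : DifferentiableAt ℝ u x) (i j : Fin d) :
    pderiv j (fun y => u y i) x = fderiv ℝ u x (EuclideanSpace.single j 1) i := by
  have h := ((EuclideanSpace.proj (𝕜 := ℝ) i).hasFDerivAt.comp x hu.hasFDerivAt).fderiv
  unfold pderiv
  rw [show (fun y => u y i) = (EuclideanSpace.proj (𝕜 := ℝ) i) ∘ u from rfl, h]
  rfl

lemma jacobian_apply {u : E d → E d} {x : E d} (hu : DifferentiableAt ℝ u x) (i j : Fin d) :
    jacobian u x i j = fderiv ℝ u x (EuclideanSpace.single j 1) i := pderiv_apply hu i j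

lemma divergence_eq {u : E d → E d} {x : E d} (hu : DifferentiableAt ℝ u x) :
    divergence u x = ∑ j, fderiv ℝ u x (EuclideanSpace.single j 1) j :=
  Finset.sum_congr rfl fun j _ => pderiv_apply hu j j

lemma sum_coord_smul_single (w : E d) : ∑ j, w j • EuclideanSpace.single j (1 : ℝ) = w := by
  ext i
  simp [Finset.sum_apply, Pi.single_apply]

lemma map_eq_sum_coord {F : Type} [NormedAddCommGroup F] [NormedSpace ℝ F] (A : E d →L[ℝ] F)
    (w : E d) : A w = ∑ j, w j • A (EuclideanSpace.single j 1) := by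
  conv_lhs => rw [← sum_coord_smul_single w]
  simp

lemma divergence_smul {a : E d → ℝ} {u : E d → E d} {x : E d} (ha : DifferentiableAt ℝ a x)
    (hu : DifferentiableAt ℝ u x) :
    divergence (fun y => a y • u y) x = fderiv ℝ a x (u x) + a x * divergence u x := by
  have h := divergence_eq (ha.smul hu)
  rw [Pi.smul_def'] at h
  rw [h, divergence_eq hu, ← Pi.smul_def', (ha.hasFDerivAt.smul hu.hasFDerivAt).fderiv,
    map_eq_sum_coord (fderiv ℝ a x) (u x)]
  simp [Finset.sum_add_distrib, Finset.mul_sum, mul_comm, add_comm]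

lemma inner_gradient {a : E d → ℝ} (x w : E d) :
    inner ℝ (gradient a x) w = fderiv ℝ a x w := by
  simp [gradient]

lemma IsC1Closure.hasContExt_gradient {a : E d → ℝ} (ha : IsC1Closure Ω a) :
    HasContExt Ω (gradient a) :=
  ha.hasContExt_fderiv.comp (Φ := fun A : E d →L[ℝ] ℝ => (InnerProductSpace.toDual ℝ (E d)).symm A)
    (InnerProductSpace.toDual ℝ (E d)).symm.continuous

lemma hasContExt_coord {u : E d → E d} (hu : HasContExt Ω u) (i : Fin d) :
    HasContExt Ω (fun x => u x i) :=
  hu.comp (Φ := fun w : E d => w i) (EuclideanSpace.proj (𝕜 := ℝ) i).continuous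

lemma IsC1Closure.hasContExt_jacobian_apply {u : E d → E d} (ho : IsOpen Ω)
    (hu : IsC1Closure Ω u) (i j : Fin d) : HasContExt Ω (fun x => jacobian u x i j) :=
  (hasContExt_coord (hu.hasContExt_fderiv.clm_apply
    (HasContExt.const (EuclideanSpace.single j 1))) i).congr
    fun _ hx => jacobian_apply (hu.differentiableAt ho hx) i j

lemma IsC1Closure.hasContExt_jacobian {u : E d → E d} (ho : IsOpen Ω)
    (hu : IsC1Closure Ω u) : HasContExt Ω (jacobian u) :=
  HasContExt.pi (F := Fin d → ℝ) fun i => HasContExt.pi fun j => hu.hasContExt_jacobian_apply ho i j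

lemma IsC1Closure.hasContExt_divergence {u : E d → E d} (ho : IsOpen Ω)
    (hu : IsC1Closure Ω u) : HasContExt Ω (divergence u) :=
  HasContExt.sum Finset.univ fun j => hu.hasContExt_jacobian_apply ho j j

lemma hasContExt_frob {A B : E d → Matrix (Fin d) (Fin d) ℝ} (hA : HasContExt Ω A)
    (hB : HasContExt Ω B) : HasContExt Ω (fun x => frob (A x) (B x)) := by
  have hcoord : ∀ {M : E d → Matrix (Fin d) (Fin d) ℝ}, HasContExt Ω M → ∀ i j,
      HasContExt Ω (fun x => M x i j) := fun hM i j =>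
    hM.comp (Φ := fun A : Matrix (Fin d) (Fin d) ℝ => A i j) (continuous_id.matrix_elem i j)
  exact HasContExt.sum Finset.univ fun i => HasContExt.sum Finset.univ fun j =>
    (hcoord hA i j).mul (hcoord hB i j)

end Operators

/-! ### Integration by parts with compactly supported Lipschitz test functions -/

section IntegrationByParts

variable {d : ℕ} {Ω : Set (E d)}

lemma exists_cutoff (ho : IsOpen Ω) {K : Set (E d)} (hK : IsCompact K) (hKΩ : K ⊆ Ω) :
    ∃ κ : E d → ℝ, ContDiff ℝ ∞ κ ∧ HasCompactSupport κ ∧ tsupport κ ⊆ Ω ∧ ∀ x ∈ K, κ x = 1 := by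
  obtain ⟨L, hL, hKL, hLΩ⟩ := exists_compact_between hK ho hKΩ
  obtain ⟨κ, hκ, -, hsupp, hone⟩ := exists_contMDiff_support_eq_eq_one_iff
    (I := modelWithCornersSelf ℝ (E d)) isOpen_interior hK.isClosed hKL
  have hts : tsupport κ ⊆ L := by
    rw [tsupport, hsupp]
    exact closure_minimal interior_subset hL.isClosed
  exact ⟨κ, contMDiff_iff_contDiff.1 hκ, hL.of_isClosed_subset (isClosed_tsupport _) hts,
    hts.trans hLΩ, fun x hx => (hone x).1 hx⟩

lemma contDiff_of_contDiffOn_of_eventually_eq_zero {F : Type} [NormedAddCommGroup F]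
    [NormedSpace ℝ F] {n : WithTop ℕ∞} (ho : IsOpen Ω)
    {u : E d → F} (hu : ContDiffOn ℝ n u Ω) (h0 : ∀ x ∉ Ω, u =ᶠ[𝓝 x] 0) : ContDiff ℝ n u := by
  rw [contDiff_iff_contDiffAt]
  intro x
  by_cases hx : x ∈ Ω
  · exact hu.contDiffAt (ho.mem_nhds hx)
  · exact contDiffAt_const.congr_of_eventuallyEq (h0 x hx)

lemma integrable_lineDeriv_mul {C : NNReal} {θ g : E d → ℝ} (hθ : LipschitzWith C θ)
    (hg : Continuous g) (hgc : HasCompactSupport g) (w : E d) :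
    Integrable (fun x => lineDeriv ℝ θ x w * g x) :=
  (hg.integrable_of_hasCompactSupport hgc).bdd_mul
    (aestronglyMeasurable_lineDeriv hθ.continuous _)
    (.of_forall fun _ => norm_lineDeriv_le_of_lipschitz ℝ hθ)

/-- Integration by parts against a Lipschitz function with compact support in `Ω`. -/
lemma integral_fderiv_add_mul_divergence (ho : IsOpen Ω) {X : E d → E d}
    (hX : ContDiffOn ℝ 1 X Ω) {C : NNReal} {θ : E d → ℝ} (hθ : LipschitzWith C θ)
    (hc : HasCompactSupport θ) (hs : tsupport θ ⊆ Ω) :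
    ∫ x in Ω, (fderiv ℝ θ x (X x) + θ x * divergence X x) = 0 := by
  obtain ⟨κ, hκ, hκc, hκs, hκ1⟩ := exists_cutoff ho hc hs
  -- Since `κ = 1` on the support of `θ`, replacing `X` by the globally `C¹` field `Y` does not
  -- change the integrand; each component of `Y` is then Lipschitz, and parts can be integrated
  -- between two Lipschitz functions.
  set Y : E d → E d := fun x => κ x • X x with hY
  have hYd : ContDiff ℝ 1 Y := by
    refine contDiff_of_contDiffOn_of_eventually_eq_zero ho
      ((hκ.of_le (by exact_mod_cast le_top)).contDiffOn.smul hX) fun x hx => ?_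
    filter_upwards [notMem_tsupport_iff_eventuallyEq.1 (fun h => hx (hκs h))] with y hy
    simp [hY, hy]
  have hYj : ∀ j, ContDiff ℝ 1 (fun x => Y x j) := fun j =>
    (EuclideanSpace.proj (𝕜 := ℝ) j).contDiff.comp hYd
  have hYc : ∀ j, HasCompactSupport (fun x => Y x j) := fun j =>
    hκc.mono fun x hx h => hx (by simp [hY, h])
  have key : ∀ᵐ x, fderiv ℝ θ x (X x) + θ x * divergence X x
      = ∑ j, (lineDeriv ℝ θ x (EuclideanSpace.single j 1) * Y x j
        - lineDeriv ℝ (fun y => Y y j) x (-EuclideanSpace.single j 1) * θ x) := by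
    -- Rademacher's theorem: line derivatives of `θ` agree with the Fréchet derivative almost
    -- everywhere.
    filter_upwards [hθ.ae_differentiableAt] with x hx
    have h1 : fderiv ℝ θ x (X x)
        = ∑ j, lineDeriv ℝ θ x (EuclideanSpace.single j 1) * Y x j := by
      by_cases hxs : x ∈ tsupport θ
      · rw [map_eq_sum_coord]
        simp [hY, hκ1 x hxs, hx.lineDeriv_eq_fderiv, mul_comm]
      · have : fderiv ℝ θ x = 0 := by
          rw [(notMem_tsupport_iff_eventuallyEq.1 hxs).fderiv_eq]; simp
        simp [hx.lineDeriv_eq_fderiv, this]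
    have h2 : θ x * divergence X x
        = ∑ j, -(lineDeriv ℝ (fun y => Y y j) x (-EuclideanSpace.single j 1) * θ x) := by
      by_cases hx0 : θ x = 0
      · simp [hx0]
      · rw [divergence, Finset.mul_sum]
        refine Finset.sum_congr rfl fun j _ => ?_
        have hev : (fun y => Y y j) =ᶠ[𝓝 x] fun y => X y j := by
          filter_upwards [hθ.continuous.continuousAt.eventually_ne hx0] with y hy
          simp [hY, hκ1 y (subset_tsupport _ hy)]
        rw [((hYj j).differentiable one_ne_zero x).lineDeriv_eq_fderiv, hev.fderiv_eq, pderiv]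
        simp [mul_comm]
    rw [h1, h2, ← Finset.sum_add_distrib]
    simp [sub_eq_add_neg]
  rw [setIntegral_eq_integral_of_forall_compl_eq_zero, integral_congr_ae key, integral_finsetSum]
  · refine Finset.sum_eq_zero fun j _ => ?_
    obtain ⟨D, hD⟩ := (hYj j).lipschitzWith_of_hasCompactSupport (hYc j) one_ne_zero
    rw [integral_sub (integrable_lineDeriv_mul hθ (hYj j).continuous (hYc j) _)
      (integrable_lineDeriv_mul hD hθ.continuous hc _),
      hθ.integral_lineDeriv_mul_eq hD (hYc j), sub_self]
  · intro j _
    obtain ⟨D, hD⟩ := (hYj j).lipschitzWith_of_hasCompactSupport (hYc j) one_ne_zero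
    exact (integrable_lineDeriv_mul hθ (hYj j).continuous (hYc j) _).sub
      (integrable_lineDeriv_mul hD hθ.continuous hc _)
  · intro x hx
    have := notMem_tsupport_iff_eventuallyEq.1 (fun h => hx (hs h))
    rw [this.fderiv_eq, this.eq_of_nhds]
    simp

end IntegrationByParts

/-! ### The smooth step used in all explicit cutoffs -/

section SmoothStep

open Real

/-- The step is constant off `[0, 1]`, and its continuous derivative is bounded on that compact
interval. The cutoff estimates below all use this single constant `M`. -/
lemma exists_bound_deriv_smoothTransition :
    ∃ M : NNReal, (∀ s, ‖deriv smoothTransition s‖ ≤ M) ∧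
      (∀ s, s ∉ Icc (0 : ℝ) 1 → deriv smoothTransition s = 0) ∧
      LipschitzWith M smoothTransition := by
  have hd : ContDiff ℝ 1 smoothTransition := smoothTransition.contDiff (n := 1)
  have hz : ∀ s, s ∉ Icc (0 : ℝ) 1 → deriv smoothTransition s = 0 := by
    intro s hs
    have : smoothTransition =ᶠ[𝓝 s] (fun _ => smoothTransition s) := by
      rcases lt_or_ge s 0 with h | h
      · filter_upwards [Iio_mem_nhds h] with y hy
        rw [smoothTransition.zero_of_nonpos (le_of_lt hy), smoothTransition.zero_of_nonpos h.le]
      · have h1 : 1 < s := by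
          by_contra h1
          exact hs ⟨h, not_lt.1 h1⟩
        filter_upwards [Ioi_mem_nhds h1] with y hy
        rw [smoothTransition.one_of_one_le (le_of_lt hy), smoothTransition.one_of_one_le h1.le]
    rw [this.deriv_eq, deriv_const]
  obtain ⟨C, hC⟩ := (isCompact_Icc (a := (0 : ℝ)) (b := 1)).exists_bound_of_continuousOn
    (hd.continuous_deriv le_rfl).continuousOn
  have hb : ∀ s, ‖deriv smoothTransition s‖ ≤ C.toNNReal := by
    intro s
    by_cases hs : s ∈ Icc (0 : ℝ) 1
    · exact (hC s hs).trans (le_coe_toNNReal C)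
    · rw [hz s hs, norm_zero]; exact NNReal.coe_nonneg _
  exact ⟨C.toNNReal, hb, hz,
    lipschitzWith_of_nnnorm_deriv_le (hd.differentiable one_ne_zero) fun s => by
      exact_mod_cast hb s⟩

lemma lipschitzWith_mul_of_bounded {α : Type} [PseudoMetricSpace α] {a b : α → ℝ}
    {Ca Cb A B : NNReal}
    (ha : LipschitzWith Ca a) (hb : LipschitzWith Cb b) (hA : ∀ x, |a x| ≤ A)
    (hB : ∀ x, |b x| ≤ B) : LipschitzWith (A * Cb + B * Ca) (fun x => a x * b x) := by
  refine LipschitzWith.of_dist_le_mul fun x y => ?_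
  have h1 := ha.dist_le_mul x y
  have h2 := hb.dist_le_mul x y
  rw [Real.dist_eq] at h1 h2 ⊢
  have h3 : a x * b x - a y * b y = a x * (b x - b y) + b y * (a x - a y) := by ring
  rw [h3]
  refine (abs_add_le _ _).trans ?_
  rw [abs_mul, abs_mul]
  push_cast
  have := mul_le_mul (hA x) h2 (abs_nonneg _) A.2
  have := mul_le_mul (hB y) h1 (abs_nonneg _) B.2
  linarith

end SmoothStep

/-! ### Layers and normals of a Lipschitz graph -/

section Graph

variable {d : ℕ} {Ω : Set (E d)} {e p : E d} {g h : E d → ℝ} {r : ℝ}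

/-- Since `h` drops at unit rate along `e`, the translates of the layer by multiples of `2 / m` are
disjoint. The `m` translates used move by less than `2`, so all lie in the ball of radius `r + 2`.
This gives the `O(1/m)` volume without Fubini. -/
lemma volume_slab_mul_le (he : ‖e‖ = 1) (hc : Continuous h)
    (hs : ∀ (x : E d) (s : ℝ), h (x + s • e) = h x - s) {m : ℕ} (hm : 0 < m) :
    volume.real {x ∈ Metric.ball p r | h x ∈ Icc (1 / m : ℝ) (2 / m)} * m
      ≤ volume.real (Metric.ball p (r + 2)) := by
  set A := {x ∈ Metric.ball p r | h x ∈ Icc (1 / m : ℝ) (2 / m)} with hA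
  have hm' : (0 : ℝ) < m := by exact_mod_cast hm
  have hAm : MeasurableSet A :=
    Metric.isOpen_ball.measurableSet.inter (hc.measurable measurableSet_Icc)
  set T : ℕ → Set (E d) := fun k => (fun x => x + (2 * k / m : ℝ) • e) ⁻¹' A with hT
  have hTm : ∀ k, MeasurableSet (T k) := fun k => (measurable_add_const _) hAm
  have hTv : ∀ k, volume.real (T k) = volume.real A := fun k => by
    rw [hT, Measure.real, Measure.real, measure_preimage_add_right]
  have hdisj : ∀ k l, k < l → Disjoint (T k) (T l) := by
    intro k l hkl
    rw [Set.disjoint_left]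
    rintro x ⟨-, -, hk⟩ ⟨-, hl, -⟩
    simp only [hs] at hk hl
    have : (k : ℝ) + 1 ≤ l := by exact_mod_cast hkl
    have h1 : (1 : ℝ) / m ≤ 2 / m + 2 * k / m - 2 * l / m := by linarith
    have h2 : (1 : ℝ) ≤ 2 + 2 * k - 2 * l := by
      have := mul_le_mul_of_nonneg_right h1 hm'.le
      field_simp at this
      linarith
    linarith
  have hsub : (⋃ k ∈ Finset.range m, T k) ⊆ Metric.ball p (r + 2) := by
    intro x hx
    simp only [mem_iUnion, Finset.mem_range] at hx
    obtain ⟨k, hk, hxA, -⟩ := hx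
    rw [Metric.mem_ball] at hxA ⊢
    have h1 : dist x (x + (2 * k / m : ℝ) • e) ≤ 2 := by
      have hk' : (k : ℝ) ≤ m := by exact_mod_cast hk.le
      rw [dist_self_add_right, norm_smul, he, mul_one, Real.norm_of_nonneg (by positivity),
        div_le_iff₀ hm']
      linarith
    linarith [dist_triangle x (x + (2 * k / m : ℝ) • e) p]
  have hne : volume (Metric.ball p (r + 2)) ≠ ⊤ := measure_ball_lt_top.ne
  calc volume.real A * m = ∑ k ∈ Finset.range m, volume.real (T k) := by
        simp [hTv, mul_comm]
    _ = volume.real (⋃ k ∈ Finset.range m, T k) := by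
        refine (measureReal_biUnion_finset ?_ (fun k _ => hTm k) fun k hk => ?_).symm
        · intro k _ l _ hkl
          rcases lt_or_gt_of_ne hkl with h | h
          · exact hdisj k l h
          · exact (hdisj l k h).symm
        · refine ne_top_of_le_ne_top hne (measure_mono ?_)
          exact (subset_biUnion_of_mem (u := T) (Finset.mem_coe.2 hk)).trans hsub
    _ ≤ _ := measureReal_mono hsub hne

/-- Differentiability of the defining function makes `Ω` asymptotically the half-space where `A` is
positive, so the outward normal is minus the normalized gradient. The slope `-1` along `e` makes `A`
nonzero and gives points of `Ω` just below `q`. -/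
lemma mem_frontier_and_isOutwardNormal (hr : ∀ x ∈ Metric.ball p r, x ∈ Ω ↔ 0 < h x)
    {q : E d} (hq : q ∈ Metric.ball p r) (hq0 : h q = 0) {A : E d →L[ℝ] ℝ}
    (hA : HasFDerivAt h A q) (hAe : A e = -1)
    (hs : ∀ (x : E d) (s : ℝ), h (x + s • e) = h x - s) :
    q ∈ frontier Ω ∧
      IsOutwardNormal Ω q (-(‖A‖⁻¹ • (InnerProductSpace.toDual ℝ (E d)).symm A)) := by
  have hA0 : 0 < ‖A‖ := norm_pos_iff.2 fun h0 => by simp [h0] at hAe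
  have hball : Metric.ball p r ∈ 𝓝 q := Metric.isOpen_ball.mem_nhds hq
  refine ⟨⟨?_, ?_⟩, ?_, ?_⟩
  · have ht : Tendsto (fun s : ℝ => q + s • e) (𝓝[<] 0) (𝓝 q) := by
      have : Continuous fun s : ℝ => q + s • e := by fun_prop
      simpa using (this.tendsto 0).mono_left nhdsWithin_le_nhds
    refine mem_closure_of_tendsto ht ?_
    filter_upwards [ht hball, self_mem_nhdsWithin] with s hsb hs0
    rw [hr _ hsb, hs, hq0]
    simpa using hs0
  · intro hi
    have := (hr q hq).1 (interior_subset hi)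
    exact this.ne' hq0
  · rw [norm_neg, norm_smul, norm_inv, norm_norm, LinearIsometryEquiv.norm_map,
      inv_mul_cancel₀ hA0.ne']
  · intro ε hε
    have hin : ∀ w, inner ℝ w (-(‖A‖⁻¹ • (InnerProductSpace.toDual ℝ (E d)).symm A))
        = -(‖A‖⁻¹ * A w) := fun w => by
      rw [inner_neg_right, real_inner_smul_right, real_inner_comm,
        InnerProductSpace.toDual_symm_apply]
    -- The factor `‖A‖` compensates for the normalization of the normal.
    have hlo := hA.isLittleO.def (c := ‖A‖ * ε) (by positivity)
    obtain ⟨δ, hδ, hδb⟩ := Metric.eventually_nhds_iff_ball.1 (hlo.and hball)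
    refine ⟨δ, hδ, fun y hy => ?_⟩
    obtain ⟨hy1, hy2⟩ := hδb y hy
    rw [hq0, sub_zero, Real.norm_eq_abs, abs_le] at hy1
    rw [hin, hr y hy2]
    have hmul : A (y - q) = ‖A‖ * (‖A‖⁻¹ * A (y - q)) := by
      rw [mul_inv_cancel_left₀ hA0.ne']
    constructor
    · intro hlt
      have := mul_lt_mul_of_pos_left hlt hA0
      nlinarith
    · intro hlt
      have := mul_lt_mul_of_pos_left hlt hA0
      rw [not_lt]
      nlinarith

end Graph

/-! ### The divergence theorem near a Lipschitz boundary point -/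

lemma integrableOn_fderiv_apply {d : ℕ} {Ω : Set (E d)} (ho : IsOpen Ω)
    (hb : Bornology.IsBounded Ω) {C : NNReal} {θ : E d → ℝ} (hθ : LipschitzWith C θ)
    {X : E d → E d} (hX : HasContExt Ω X) : IntegrableOn (fun x => fderiv ℝ θ x (X x)) Ω := by
  refine Integrable.mono' (g := fun x => C * ‖X x‖)
    ((hX.integrableOn ho hb).norm.const_mul _) ?_ (.of_forall fun x => ?_)
  · exact (ContinuousLinearMap.id ℝ (E d →L[ℝ] ℝ)).aestronglyMeasurable_comp₂
      (measurable_fderiv ℝ θ).aestronglyMeasurable (hX.integrableOn ho hb).aestronglyMeasurable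
  · exact ((fderiv ℝ θ x).le_opNorm _).trans
      (mul_le_mul_of_nonneg_right (norm_fderiv_le_of_lipschitz ℝ hθ) (norm_nonneg _))

section LocalDivergence

variable {d : ℕ} {Ω : Set (E d)}

lemma exists_lipschitzWith_bound {χ : E d → ℝ} (hχ : ContDiff ℝ ∞ χ) (hc : HasCompactSupport χ) :
    ∃ C B : NNReal, LipschitzWith C χ ∧ ∀ x, |χ x| ≤ B := by
  obtain ⟨C, hC⟩ := hχ.lipschitzWith_of_hasCompactSupport hc (by simp)
  obtain ⟨B, hB⟩ := hχ.continuous.bounded_above_of_compact_support hc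
  exact ⟨C, B.toNNReal, hC, fun x => (hB x).trans (Real.le_coe_toNNReal B)⟩

lemma IsC1Closure.hasContExt_fderiv_add_mul_divergence (ho : IsOpen Ω) {X : E d → E d}
    (hX : IsC1Closure Ω X) {χ : E d → ℝ} (hχ : ContDiff ℝ ∞ χ) :
    HasContExt Ω (fun x => fderiv ℝ χ x (X x) + χ x * divergence X x) :=
  (((hχ.continuous_fderiv (by simp)).continuousOn.hasContExt).clm_apply hX.hasContExt).add
    (hχ.continuous.continuousOn.hasContExt.mul (hX.hasContExt_divergence ho))

/-- Cut `χ` off at depth `1 / m` below the graph and integrate by parts. The error is the integral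
of `χ` times the cutoff's derivative along `X`: a factor `m`, a layer of volume `O(1/m)`, and `∇h ·
X`, which is uniformly small there because `∇h(x)` is normal to the boundary at the projection of
`x` along `e`, where `X` is tangential. -/
lemma IsLipschitzBoundaryPoint.integral_eq_zero (ho : IsOpen Ω) (hb : Bornology.IsBounded Ω)
    {X : E d → E d} (hX : IsC1Closure Ω X)
    (hXn : ∀ x ∈ frontier Ω, ∀ n, IsOutwardNormal Ω x n → inner ℝ (X x) n = 0)
    {p : E d} (hp : IsLipschitzBoundaryPoint Ω p) :
    ∃ r > 0, ∀ χ : E d → ℝ, ContDiff ℝ ∞ χ → HasCompactSupport χ →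
      tsupport χ ⊆ Metric.ball p r →
      ∫ x in Ω, (fderiv ℝ χ x (X x) + χ x * divergence X x) = 0 := by
  obtain ⟨e, g, K, r, he, hg, hge, hr, hΩ⟩ := hp
  set h : E d → ℝ := fun x => g x - inner ℝ x e with hh
  have hee : inner ℝ e e = (1 : ℝ) := by rw [real_inner_self_eq_norm_sq, he]; norm_num
  have hs : ∀ (x : E d) (s : ℝ), h (x + s • e) = h x - s := fun x s => by
    simp only [hh, hge, inner_add_left, real_inner_smul_left, hee]; ring
  have hr' : ∀ x ∈ Metric.ball p r, x ∈ Ω ↔ 0 < h x := fun x hx => by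
    rw [hΩ x hx, hh, sub_pos]
  have hL : LipschitzWith (K + 1) h := by
    refine hg.sub (LipschitzWith.of_dist_le_mul fun x y => ?_)
    rw [Real.dist_eq, ← inner_sub_left, dist_eq_norm]
    refine (abs_real_inner_le_norm _ _).trans ?_
    rw [he]; simp
  obtain ⟨M, hM, hM0, hML⟩ := exists_bound_deriv_smoothTransition
  -- Half the radius leaves room for the projection along `e`, by at most `2 / m < r / 2`, to stay
  -- in the ball where `Ω` is a subgraph.
  refine ⟨r / 2, half_pos hr, fun χ hχ hχc hχs => ?_⟩
  obtain ⟨Cχ, B, hCχ, hB⟩ := exists_lipschitzWith_bound hχ hχc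
  set Q : E d → ℝ := fun x => fderiv ℝ χ x (X x) + χ x * divergence X x with hQ
  have hQe : HasContExt Ω Q := hX.hasContExt_fderiv_add_mul_divergence ho hχ
  have hQi : IntegrableOn Q Ω := hQe.integrableOn ho hb
  -- Zero where `h ≤ 1 / m`, one where `h ≥ 2 / m`; the support of `χ * w m` therefore stays inside
  -- `Ω`.
  set w : ℕ → E d → ℝ := fun m x => Real.smoothTransition (m * h x - 1) with hw
  have hwL : ∀ m : ℕ, LipschitzWith (M * (m * (K + 1))) (w m) := fun m => by
    refine hML.comp (LipschitzWith.of_dist_le_mul fun x y => ?_)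
    have := hL.dist_le_mul x y
    rw [Real.dist_eq] at this ⊢
    rw [sub_sub_sub_cancel_right, ← mul_sub, abs_mul, Nat.abs_cast]
    push_cast at this ⊢
    rw [mul_assoc]
    exact mul_le_mul_of_nonneg_left this (Nat.cast_nonneg m)
  have hw1 : ∀ m x, |w m x| ≤ (1 : NNReal) := fun m x => by
    rw [abs_of_nonneg (Real.smoothTransition.nonneg _)]
    exact Real.smoothTransition.le_one _
  have hθL := fun m => lipschitzWith_mul_of_bounded hCχ (hwL m) hB (hw1 m)
  -- the truncated integrals tend to the full one
  have hlim : Tendsto (fun m : ℕ => ∫ x in Ω, w m x * Q x) atTop (𝓝 (∫ x in Ω, Q x)) := by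
    refine tendsto_integral_of_dominated_convergence (fun x => ‖Q x‖)
      (fun m => (hwL m).continuous.aestronglyMeasurable.mul hQi.aestronglyMeasurable) hQi.norm
      (fun m => .of_forall fun x => ?_) ?_
    · rw [norm_mul]
      exact mul_le_of_le_one_left (norm_nonneg _) (hw1 m x)
    · filter_upwards [ae_restrict_mem ho.measurableSet] with x hx
      by_cases hxs : x ∈ tsupport χ
      · have hpos : 0 < h x :=
          (hr' x (Metric.ball_subset_ball (half_le_self hr.le) (hχs hxs))).1 hx
        refine tendsto_const_nhds.congr' ?_
        filter_upwards [eventually_ge_atTop ⌈2 / h x⌉₊] with m hm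
        have h2 : 2 ≤ m * h x := by
          rw [← div_le_iff₀ hpos]
          exact Nat.ceil_le.1 hm
        simp only [hw]
        rw [Real.smoothTransition.one_of_one_le (by linarith), one_mul]
      · have h0 := notMem_tsupport_iff_eventuallyEq.1 hxs
        have : Q x = 0 := by
          simp only [hQ]
          rw [h0.fderiv_eq, h0.eq_of_nhds]
          simp
        simp [this]
  set V : ℝ := volume.real (Metric.ball p (r + 2)) with hV
  -- the truncated integrals are small
  have hsmall : ∀ κ > 0, ∀ᶠ m : ℕ in atTop,
      ‖∫ x in Ω, w m x * Q x‖ ≤ B * M * ((K + 1) * κ) * V := by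
    intro κ hκ
    obtain ⟨δ, hδ, hδX⟩ := Metric.uniformContinuousOn_iff.1
      (hb.isCompact_closure.uniformContinuousOn_of_continuous hX.1) κ hκ
    filter_upwards [eventually_gt_atTop (max ⌈2 / δ⌉₊ ⌈2 / (r / 2)⌉₊)] with m hm
    have hm0 : 0 < m := (Nat.zero_le _).trans_lt hm
    have hm' : (0 : ℝ) < m := by exact_mod_cast hm0
    have hmδ : (2 : ℝ) / m < δ := by
      rw [div_lt_comm₀ hm' hδ]
      exact (Nat.le_ceil _).trans_lt (by exact_mod_cast (le_max_left _ _).trans_lt hm)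
    have hmr : (2 : ℝ) / m < r / 2 := by
      rw [div_lt_comm₀ hm' (half_pos hr)]
      exact (Nat.le_ceil _).trans_lt (by exact_mod_cast (le_max_right _ _).trans_lt hm)
    have hsupp : {x | x ∈ tsupport χ ∧ (1 : ℝ) / m ≤ h x} ⊆ Ω := by
      rintro x ⟨hx, hxm⟩
      rw [hr' x (Metric.ball_subset_ball (half_le_self hr.le) (hχs hx))]
      exact lt_of_lt_of_le (by positivity) hxm
    have hts : tsupport (fun x => χ x * w m x) ⊆ {x | x ∈ tsupport χ ∧ (1 : ℝ) / m ≤ h x} := by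
      refine closure_minimal (fun x hx => ?_)
        ((isClosed_tsupport _).inter (isClosed_le continuous_const hL.continuous))
      obtain ⟨hx1, hx2⟩ := mul_ne_zero_iff.1 (Function.mem_support.1 hx)
      refine ⟨subset_tsupport _ hx1, ?_⟩
      by_contra hlt
      rw [not_le, lt_div_iff₀ hm'] at hlt
      exact hx2 (Real.smoothTransition.zero_of_nonpos (by linarith))
    have hibp := integral_fderiv_add_mul_divergence ho (hX.contDiffOn ho) (hθL m)
      (hχc.mul_right (f' := w m)) (hts.trans hsupp)
    set tot : E d → ℝ := fun x => fderiv ℝ (fun x => χ x * w m x) x (X x)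
      + χ x * w m x * divergence X x with htot
    have htoti : IntegrableOn tot Ω :=
      (integrableOn_fderiv_apply ho hb (hθL m) hX.hasContExt).add
        (((hθL m).continuous.continuousOn.hasContExt.mul
          (hX.hasContExt_divergence ho)).integrableOn ho hb)
    have hwQi : IntegrableOn (fun x => w m x * Q x) Ω :=
      ((hwL m).continuous.continuousOn.hasContExt.mul hQe).integrableOn ho hb
    have heq : ∫ x in Ω, w m x * Q x = ∫ x in Ω, (w m x * Q x - tot x) := by
      rw [integral_sub hwQi htoti, hibp, sub_zero]
    set A := {x ∈ Metric.ball p r | h x ∈ Icc (1 / m : ℝ) (2 / m)} with hA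
    have hAm : MeasurableSet A :=
      Metric.isOpen_ball.measurableSet.inter (hL.continuous.measurable measurableSet_Icc)
    have hAfin : volume A ≠ ⊤ :=
      ne_top_of_le_ne_top measure_ball_lt_top.ne (measure_mono fun x hx => hx.1)
    have hpt : ∀ᵐ x ∂(volume.restrict Ω), ‖w m x * Q x - tot x‖
        ≤ A.indicator (fun _ => B * M * m * ((K + 1) * κ)) x := by
      filter_upwards [ae_restrict_mem ho.measurableSet, ae_restrict_of_ae hL.ae_differentiableAt]
        with x hx hxd
      have hwd : HasFDerivAt (w m)
          ((deriv Real.smoothTransition (m * h x - 1)) • ((m : ℝ) • fderiv ℝ h x)) x :=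
        ((Real.smoothTransition.contDiff (n := 1)).differentiable one_ne_zero
          _).hasDerivAt.comp_hasFDerivAt x ((hxd.hasFDerivAt.const_mul (m : ℝ)).sub_const 1)
      have hχd : HasFDerivAt χ (fderiv ℝ χ x) x :=
        (hχ.differentiable (by simp) x).hasFDerivAt
      -- Only the term in which the derivative falls on `w m` survives.
      have hval : w m x * Q x - tot x
          = -(χ x * deriv Real.smoothTransition (m * h x - 1) * m * fderiv ℝ h x (X x)) := by
        simp only [htot, hQ]
        have hprod := (hχd.mul hwd).fderiv
        rw [Pi.mul_def] at hprod
        rw [hprod]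
        simp
        ring
      rw [hval, norm_neg]
      by_cases hxA : x ∈ A
      · rw [indicator_of_mem hxA]
        obtain ⟨hxp, -, hx2⟩ := hxA
        have hA1 : ‖χ x * deriv Real.smoothTransition (m * h x - 1) * m‖ ≤ B * M * m := by
          rw [norm_mul, norm_mul, Real.norm_of_nonneg hm'.le]
          gcongr
          · exact hB x
          · exact hM _
        by_cases hxs : x ∈ tsupport χ
        swap
        · rw [image_eq_zero_of_notMem_tsupport hxs]
          simp only [zero_mul, norm_zero]
          positivity
        rw [norm_mul]
        refine mul_le_mul hA1 ?_ (norm_nonneg _) (by positivity)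
        have hpos : 0 < h x := (hr' x hxp).1 hx
        set q := x + h x • e with hq
        have hqd : dist x q = h x := by
          rw [hq, dist_self_add_right, norm_smul, he, mul_one, Real.norm_of_nonneg hpos.le]
        have hqp : q ∈ Metric.ball p r := by
          have := hχs hxs
          rw [Metric.mem_ball] at this ⊢
          have := dist_triangle_left q p x
          linarith
        have hq0 : h q = 0 := by rw [hq, hs, sub_self]
        -- Translation along `e` changes `h` only by a constant, so differentiability passes from
        -- almost every `x` to its projection `q`, although the boundary itself may be a null set.
        have hder : HasFDerivAt h (fderiv ℝ h x) q := by
          have h1 : HasFDerivAt (fun y => h (y + (-h x) • e)) (fderiv ℝ h x) q := by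
            have h2 : HasFDerivAt h (fderiv ℝ h x) (q + (-h x) • e) := by
              rw [hq, add_assoc, ← add_smul, add_neg_cancel, zero_smul, add_zero]
              exact hxd.hasFDerivAt
            exact h2.comp q ((hasFDerivAt_id q).add_const ((-h x) • e))
          have h3 : (fun y => h (y + (-h x) • e) + -h x) = h := by
            funext y
            rw [hs]; ring
          exact (h1.add_const (-h x)).congr_of_eventuallyEq (.of_eq h3.symm)
        have hAe : fderiv ℝ h x e = -1 := by
          have h1 : HasDerivAt (fun s : ℝ => h (x + s • e)) (fderiv ℝ h x e) 0 :=
            hxd.hasFDerivAt.hasLineDerivAt e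
          have h2 : HasDerivAt (fun s : ℝ => h (x + s • e)) (-1) 0 := by
            simp only [hs]
            exact (hasDerivAt_id (0 : ℝ)).const_sub (h x)
          exact h1.unique h2
        obtain ⟨hqf, hqn⟩ := mem_frontier_and_isOutwardNormal hr' hqp hq0 hder hAe hs
        have hXq : fderiv ℝ h x (X q) = 0 := by
          have h1 := hXn q hqf _ hqn
          have hA0 : ‖fderiv ℝ h x‖ ≠ 0 := norm_ne_zero_iff.2 fun h0 => by simp [h0] at hAe
          rw [inner_neg_right, real_inner_smul_right, real_inner_comm,
            InnerProductSpace.toDual_symm_apply, neg_eq_zero, mul_eq_zero] at h1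
          exact h1.resolve_left (inv_ne_zero hA0)
        have hXx : ‖X x - X q‖ ≤ κ := by
          rw [← dist_eq_norm]
          exact (hδX x (subset_closure hx) q (frontier_subset_closure hqf) (by linarith)).le
        rw [← sub_zero (fderiv ℝ h x (X x)), ← hXq, ← map_sub]
        refine ((fderiv ℝ h x).le_opNorm _).trans
          (mul_le_mul ?_ hXx (norm_nonneg _) (by positivity))
        exact_mod_cast norm_fderiv_le_of_lipschitz ℝ hL
      -- Off the layer either `χ` or the derivative of the step vanishes.
      · rw [indicator_of_notMem hxA]
        by_cases hxs : x ∈ tsupport χ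
        · have : deriv Real.smoothTransition (m * h x - 1) = 0 := by
            refine hM0 _ fun hmem => hxA
              ⟨Metric.ball_subset_ball (half_le_self hr.le) (hχs hxs), ?_, ?_⟩
            · rw [div_le_iff₀ hm']; linarith [hmem.1]
            · rw [le_div_iff₀ hm']; linarith [hmem.2]
          simp [this]
        · simp [image_eq_zero_of_notMem_tsupport hxs]
    rw [heq]
    refine (norm_integral_le_of_norm_le
      (((integrable_indicator_iff hAm).2 (integrableOn_const hAfin)).restrict (s := Ω)) hpt).trans ?_
    have h1 : ∫ x in Ω, A.indicator (fun _ => B * M * m * ((K + 1) * κ)) x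
        ≤ ∫ x, A.indicator (fun _ => B * M * m * ((K + 1) * κ)) x := by
      refine setIntegral_le_integral ((integrable_indicator_iff hAm).2 (integrableOn_const hAfin))
        (.of_forall fun x => indicator_nonneg (fun _ _ => by positivity) x)
    refine h1.trans ?_
    rw [integral_indicator_const _ hAm, smul_eq_mul]
    calc volume.real A * (B * M * m * ((K + 1) * κ))
        = B * M * ((K + 1) * κ) * (volume.real A * m) := by ring
      _ ≤ _ := mul_le_mul_of_nonneg_left (volume_slab_mul_le he hL.continuous hs hm0)
          (by positivity)
  by_contra hne
  set c := ‖∫ x in Ω, Q x‖ with hc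
  have hcpos : 0 < c := norm_pos_iff.2 hne
  set D : ℝ := B * M * (K + 1) * V with hD
  have hD0 : 0 ≤ D := by positivity
  have := le_of_tendsto hlim.norm (hsmall (c / (2 * (D + 1))) (by positivity))
  have h2 : B * M * ((K + 1) * (c / (2 * (D + 1)))) * V = c * (D / (2 * (D + 1))) := by
    rw [hD]; ring
  rw [h2] at this
  have h3 : D / (2 * (D + 1)) < 1 := by
    rw [div_lt_one (by positivity)]; linarith
  nlinarith

end LocalDivergence

/-! ### Localization and removal of the singular boundary set -/

section Localization

variable {d : ℕ} {Ω : Set (E d)}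

/-- The integrand is linear in `χ`, so a partition of unity over finitely many of the given balls
splits it. Only the compact set `closure Ω ∩ tsupport χ` has to be covered; `χ` itself need not have
compact support. -/
lemma integral_eq_zero_of_locally (ho : IsOpen Ω) (hb : Bornology.IsBounded Ω)
    {X : E d → E d} (hX : IsC1Closure Ω X) {χ : E d → ℝ} (hχ : ContDiff ℝ ∞ χ)
    (hloc : ∀ p ∈ closure Ω ∩ tsupport χ, ∃ r > 0, ∀ ψ : E d → ℝ, ContDiff ℝ ∞ ψ →
      HasCompactSupport ψ → tsupport ψ ⊆ Metric.ball p r →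
      ∫ x in Ω, (fderiv ℝ ψ x (X x) + ψ x * divergence X x) = 0) :
    ∫ x in Ω, (fderiv ℝ χ x (X x) + χ x * divergence X x) = 0 := by
  choose! r hr hr0 using hloc
  have hK : IsCompact (closure Ω ∩ tsupport χ) :=
    hb.isCompact_closure.inter_right (isClosed_tsupport χ)
  obtain ⟨t, ht, htK⟩ := hK.elim_nhds_subcover (fun p => Metric.ball p (r p))
    fun p hp => Metric.ball_mem_nhds p (hr p hp)
  obtain ⟨f, hf⟩ := SmoothPartitionOfUnity.exists_isSubordinate
    (modelWithCornersSelf ℝ (E d)) hK.isClosed (fun p : t => Metric.ball p.1 (r p.1))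
    (fun _ => Metric.isOpen_ball) (by simpa [iUnion_subtype] using htK)
  have hfs : ∀ i, ContDiff ℝ ∞ (f i) := fun i => contMDiff_iff_contDiff.1 (f i).contMDiff
  have hψ : ∀ i, ContDiff ℝ ∞ (fun x => f i x * χ x) := fun i => (hfs i).mul hχ
  have hψs : ∀ i : t, tsupport (fun x => f i x * χ x) ⊆ Metric.ball i.1 (r i.1) := fun i =>
    (tsupport_mul_subset_left (f := f i) (g := χ)).trans (hf i)
  have hsum : ∀ x ∈ Ω, χ x = ∑ i, f i x * χ x := by
    intro x hx
    by_cases hxs : x ∈ tsupport χ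
    · have := f.sum_eq_one ⟨subset_closure hx, hxs⟩
      rw [finsum_eq_sum_of_fintype] at this
      rw [← Finset.sum_mul, this, one_mul]
    · simp [image_eq_zero_of_notMem_tsupport hxs]
  have hpt : ∀ x ∈ Ω, fderiv ℝ χ x (X x) + χ x * divergence X x
      = ∑ i, (fderiv ℝ (fun x => f i x * χ x) x (X x) + f i x * χ x * divergence X x) := by
    intro x hx
    have hev : χ =ᶠ[𝓝 x] fun y => ∑ i, f i y * χ y := by
      filter_upwards [ho.mem_nhds hx] with y hy using hsum y hy
    rw [hev.fderiv_eq, fderiv_fun_sum fun i _ => ((hψ i).differentiable (by simp) x)]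
    conv_lhs => rw [hsum x hx]
    simp [Finset.sum_add_distrib, Finset.sum_mul]
  rw [setIntegral_congr_fun ho.measurableSet hpt, integral_finsetSum]
  · refine Finset.sum_eq_zero fun i _ => hr0 i.1 (ht i.1 i.2) _ (hψ i) ?_ (hψs i)
    exact Metric.isCompact_of_isClosed_isBounded (isClosed_tsupport _)
      (Metric.isBounded_ball.subset (hψs i))
  · exact fun i _ => (hX.hasContExt_fderiv_add_mul_divergence ho (hψ i)).integrableOn ho hb

/-- A compact set of vanishing `(d-1)`-dimensional Hausdorff measure is covered by finitely many
small balls. -/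
lemma exists_finite_ball_cover (hd : 1 ≤ d) {Z : Set (E d)} (hZ : IsCompact Z)
    (hZ0 : Measure.hausdorffMeasure ((d : ℝ) - 1) Z = 0) {δ : ℝ} (hδ : 0 < δ) :
    ∃ (ι : Type) (s : Finset ι) (c : ι → E d) (r : ι → ℝ), (∀ i, 0 < r i ∧ r i ≤ 1) ∧
      Z ⊆ ⋃ i ∈ s, Metric.ball (c i) (r i) ∧ ∑ i ∈ s, r i ^ (d - 1) ≤ δ := by
  have hδ2 : (0 : ENNReal) < ENNReal.ofReal (δ / 2) := by simpa using hδ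
  have hdk : ((d : ℝ) - 1) = ((d - 1 : ℕ) : ℝ) := by rw [Nat.cast_sub hd, Nat.cast_one]
  rw [Measure.hausdorffMeasure_apply] at hZ0
  have hlt := lt_of_le_of_lt ((le_iSup₂ (f := fun (r : ENNReal) (_ : 0 < r) =>
    ⨅ (t : ℕ → Set (E d)) (_ : Z ⊆ ⋃ n, t n) (_ : ∀ n, Metric.ediam (t n) ≤ r),
      ∑' n, ⨆ _ : (t n).Nonempty, Metric.ediam (t n) ^ ((d : ℝ) - 1))
    (ENNReal.ofReal (1 / 2)) (by simp)).trans hZ0.le) hδ2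
  simp only [iInf_lt_iff] at hlt
  obtain ⟨t, htZ, htd, hts⟩ := hlt
  obtain ⟨ε, hε, hεs⟩ := ENNReal.exists_pos_sum_of_countable hδ2.ne' ℕ
  -- Each nonempty set lies in a ball about one of its points with radius slightly above its
  -- diameter, which may be zero; the summable errors `ε n` pay for the excess. Empty sets are
  -- dropped, which matters for `d = 1`, where the exponent is `0`.
  have hball : ∀ n : {n // (t n).Nonempty}, ∃ (c : E d) (r : ℝ), 0 < r ∧ r ≤ 1 ∧
      t n ⊆ Metric.ball c r ∧
      ENNReal.ofReal (r ^ (d - 1)) ≤ Metric.ediam (t n) ^ ((d : ℝ) - 1) + ε n := by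
    rintro ⟨n, hn⟩
    obtain ⟨c, hc⟩ := hn
    change ∃ (c : E d) (r : ℝ), 0 < r ∧ r ≤ 1 ∧ t n ⊆ Metric.ball c r ∧
      ENNReal.ofReal (r ^ (d - 1)) ≤ Metric.ediam (t n) ^ ((d : ℝ) - 1) + ε n
    set D := (Metric.ediam (t n)).toReal with hD
    have hfin : Metric.ediam (t n) ≠ ⊤ := ne_top_of_le_ne_top ENNReal.ofReal_ne_top (htd n)
    have hDD : Metric.ediam (t n) = ENNReal.ofReal D := (ENNReal.ofReal_toReal hfin).symm
    have hD0 : 0 ≤ D := ENNReal.toReal_nonneg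
    have hD1 : D < 1 := by
      have := ENNReal.toReal_mono ENNReal.ofReal_ne_top (htd n)
      rw [ENNReal.toReal_ofReal (by norm_num)] at this
      exact this.trans_lt (by norm_num)
    have hev : ∀ᶠ s in 𝓝[>] D, s ^ (d - 1) < D ^ (d - 1) + ε n := by
      have : ContinuousAt (fun s : ℝ => s ^ (d - 1)) D := by fun_prop
      exact (this.mono_left nhdsWithin_le_nhds).eventually
        (gt_mem_nhds (lt_add_of_pos_right _ (hε n)))
    obtain ⟨s, hs1, hs2, hs3⟩ := (hev.and
      ((eventually_mem_nhdsWithin (a := D) (s := Ioi D)).and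
        ((gt_mem_nhds hD1).filter_mono nhdsWithin_le_nhds))).exists
    refine ⟨c, s, hD0.trans_lt hs2, le_of_lt hs3, fun y hy => ?_, ?_⟩
    · refine lt_of_le_of_lt ?_ (show D < s from hs2)
      rw [hD, dist_edist]
      exact ENNReal.toReal_mono hfin (Metric.edist_le_ediam_of_mem hy hc)
    · rw [hDD, hdk, ENNReal.rpow_natCast, ← ENNReal.ofReal_pow hD0,
        ← ENNReal.ofReal_coe_nnreal, ← ENNReal.ofReal_add (by positivity) (NNReal.coe_nonneg _)]
      exact ENNReal.ofReal_le_ofReal hs1.le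
  choose c r hr hr1 htb hrd using hball
  obtain ⟨s, hs⟩ := hZ.elim_finite_subcover (fun n => Metric.ball (c n) (r n))
    (fun _ => Metric.isOpen_ball) fun z hz => by
      obtain ⟨n, hn⟩ := mem_iUnion.1 (htZ hz)
      exact mem_iUnion.2 ⟨⟨n, z, hn⟩, htb ⟨n, z, hn⟩ hn⟩
  refine ⟨_, s, c, r, fun i => ⟨hr i, hr1 i⟩, hs, ?_⟩
  rw [← ENNReal.ofReal_le_ofReal_iff hδ.le,
    ENNReal.ofReal_sum_of_nonneg fun i _ => pow_nonneg (hr i).le _]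
  calc ∑ i ∈ s, ENNReal.ofReal (r i ^ (d - 1))
      ≤ ∑ i ∈ s, ((⨆ _ : (t i).Nonempty, Metric.ediam (t i) ^ ((d : ℝ) - 1)) + ε i) := by
        refine Finset.sum_le_sum fun i _ => ?_
        rw [iSup_pos i.2]
        exact hrd i
    _ = ∑ n ∈ s.map (Function.Embedding.subtype _),
          ((⨆ _ : (t n).Nonempty, Metric.ediam (t n) ^ ((d : ℝ) - 1)) + ε n) := by
        rw [Finset.sum_map]; rfl
    _ ≤ (∑' n, ⨆ _ : (t n).Nonempty, Metric.ediam (t n) ^ ((d : ℝ) - 1)) + ∑' n, (ε n : ENNReal) := by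
        rw [← ENNReal.tsum_add]
        exact ENNReal.sum_le_tsum _
    _ ≤ ENNReal.ofReal (δ / 2) + ENNReal.ofReal (δ / 2) := add_le_add hts.le hεs.le
    _ = ENNReal.ofReal δ := by
        rw [← ENNReal.ofReal_add (by positivity) (by positivity), add_halves]

/-- A smooth function that is `1` on `ball c r` and `0` outside of `ball c (2 * r)`. -/
lemma exists_ball_cutoff {M : NNReal} (hM : ∀ s, ‖deriv Real.smoothTransition s‖ ≤ M)
    (c : E d) {r : ℝ} (hr : 0 < r) :
    ∃ b : E d → ℝ, ContDiff ℝ ∞ b ∧ (∀ x, 0 ≤ b x) ∧ (∀ x ∈ Metric.ball c r, b x = 1) ∧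
      (∀ x, b x ≤ (Metric.ball c (2 * r)).indicator 1 x) ∧
      ∀ x, ‖fderiv ℝ b x‖ ≤ (Metric.ball c (2 * r)).indicator (fun _ => 4 * M / r) x := by
  -- At least `1` on the ball of radius `r` and at most `-2` outside the doubled ball; on the latter
  -- the gradient is at most `4 / r`.
  set a : E d → ℝ := fun x => 2 - (r ^ 2)⁻¹ * ‖x - c‖ ^ 2 with ha
  have had : ContDiff ℝ ∞ a := by
    have : ContDiff ℝ ∞ fun x : E d => ‖x - c‖ ^ 2 := (contDiff_id.sub contDiff_const).norm_sq ℝ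
    exact contDiff_const.sub (contDiff_const.mul this)
  have hout : ∀ x ∉ Metric.ball c (2 * r), a x < 0 := by
    intro x hx
    rw [Metric.mem_ball, not_lt, dist_eq_norm] at hx
    have h1 : (2 * r) ^ 2 ≤ ‖x - c‖ ^ 2 := pow_le_pow_left₀ (by positivity) hx 2
    have h2 := mul_le_mul_of_nonneg_left h1 (inv_nonneg.2 (sq_nonneg r))
    rw [mul_pow, mul_left_comm, inv_mul_cancel₀ (by positivity)] at h2
    simp only [ha]
    linarith
  refine ⟨fun x => Real.smoothTransition (a x), Real.smoothTransition.contDiff.comp had,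
    fun x => Real.smoothTransition.nonneg _, fun x hx => ?_, fun x => ?_, fun x => ?_⟩
  · refine Real.smoothTransition.one_of_one_le ?_
    rw [Metric.mem_ball, dist_eq_norm] at hx
    have h1 : ‖x - c‖ ^ 2 ≤ r ^ 2 := pow_le_pow_left₀ (norm_nonneg _) hx.le 2
    have h2 := mul_le_mul_of_nonneg_left h1 (inv_nonneg.2 (sq_nonneg r))
    rw [inv_mul_cancel₀ (by positivity)] at h2
    simp only [ha]
    linarith
  · by_cases hx : x ∈ Metric.ball c (2 * r)
    · rw [indicator_of_mem hx]
      exact Real.smoothTransition.le_one _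
    · rw [indicator_of_notMem hx]
      exact (Real.smoothTransition.zero_of_nonpos (hout x hx).le).le
  · by_cases hx : x ∈ Metric.ball c (2 * r)
    · rw [indicator_of_mem hx]
      rw [Metric.mem_ball, dist_eq_norm] at hx
      have h1 : HasFDerivAt a (-((r ^ 2)⁻¹ • (2 • (innerSL ℝ (x - c)).comp
          (ContinuousLinearMap.id ℝ (E d))))) x :=
        ((((hasFDerivAt_id x).sub_const c).norm_sq).const_mul _).const_sub 2
      have h2 := ((Real.smoothTransition.contDiff (n := 1)).differentiable one_ne_zero
          (a x)).hasDerivAt.comp_hasFDerivAt x h1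
      have h3 := h2.fderiv
      rw [Function.comp_def] at h3
      rw [h3, norm_smul, norm_neg, norm_smul, ContinuousLinearMap.comp_id,
        ← Nat.cast_smul_eq_nsmul ℝ, norm_smul, innerSL_apply_norm, Real.norm_of_nonneg
          (by positivity : 0 ≤ (r ^ 2)⁻¹)]
      calc ‖deriv Real.smoothTransition (a x)‖ * ((r ^ 2)⁻¹ * (‖((2 : ℕ) : ℝ)‖ * ‖x - c‖))
          ≤ M * ((r ^ 2)⁻¹ * (2 * (2 * r))) := by
            gcongr
            · exact hM _
            · simp
        _ = 4 * M / r := by field_simp; ring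
    · rw [indicator_of_notMem hx]
      have h0 : (fun y => Real.smoothTransition (a y)) =ᶠ[𝓝 x] fun _ => 0 := by
        filter_upwards [had.continuous.continuousAt.eventually_lt continuousAt_const (hout x hx)]
          with y hy using Real.smoothTransition.zero_of_nonpos (le_of_lt hy)
      rw [h0.fderiv_eq]
      simp

/-- The divergence theorem for fields of class `C¹(closure Ω)` without normal component on the
boundary. -/
theorem IsAdmissibleDomain.integral_divergence_eq_zero (hd : 1 ≤ d) (hΩ : IsAdmissibleDomain Ω)
    {X : E d → E d} (hX : IsC1Closure Ω X)
    (hXn : ∀ x ∈ frontier Ω, ∀ n, IsOutwardNormal Ω x n → inner ℝ (X x) n = 0) :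
    ∫ x in Ω, divergence X x = 0 := by
  obtain ⟨ho, hb, Z₀, hZc, hZ0, hreg⟩ := hΩ
  set Z := frontier Ω ∩ Z₀ with hZ
  have hZcomp : IsCompact Z :=
    (hb.isCompact_closure.of_isClosed_subset isClosed_frontier frontier_subset_closure).inter_right
      hZc
  have hZm : Measure.hausdorffMeasure ((d : ℝ) - 1) Z = 0 := measure_mono_null inter_subset_right hZ0
  obtain ⟨M, hM, -, hML⟩ := exists_bound_deriv_smoothTransition
  obtain ⟨CX, hCX0, hCX⟩ := hX.hasContExt.exists_bound hb
  obtain ⟨CD, hCD0, hCD⟩ := (hX.hasContExt_divergence ho).exists_bound hb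
  set B : ℝ := (4 * M * M * CX + M * CD) * (2 ^ d * volume.real (Metric.ball (0 : E d) 1)) with hB
  have hB0 : 0 ≤ B := by positivity
  have main : ∀ δ > 0, ‖∫ x in Ω, divergence X x‖ ≤ B * δ := by
    intro δ hδ
    obtain ⟨ι, s, c, r, hr, hcov, hsum⟩ := exists_finite_ball_cover hd hZcomp hZm hδ
    choose b hbs hb0 hb1 hbi hbd using fun i => exists_ball_cutoff hM (c i) (hr i).1
    -- `ψ` vanishes on the balls covering `Z` and equals `1` off the doubled balls, so with the
    -- factor `ψ` only interior and Lipschitz boundary points matter.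
    set ψ : E d → ℝ := fun x => Real.smoothTransition (1 - ∑ i ∈ s, b i x) with hψ
    have hψs : ContDiff ℝ ∞ ψ :=
      Real.smoothTransition.contDiff.comp (contDiff_const.sub (ContDiff.sum fun i _ => hbs i))
    have hψZ : Disjoint (tsupport ψ) Z := by
      have : tsupport ψ ⊆ (⋃ i ∈ s, Metric.ball (c i) (r i))ᶜ := by
        refine closure_minimal (fun x hx hxU => hx ?_)
          (isOpen_biUnion fun i _ => Metric.isOpen_ball).isClosed_compl
        simp only [mem_iUnion] at hxU
        obtain ⟨i, hi, hxi⟩ := hxU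
        refine Real.smoothTransition.zero_of_nonpos ?_
        have := Finset.single_le_sum (f := fun i => b i x) (fun i _ => hb0 i x) hi
        simp only [hb1 i x hxi] at this
        linarith
      exact disjoint_left.2 fun x hx hxZ => this hx (hcov hxZ)
    have hzero : ∫ x in Ω, (fderiv ℝ ψ x (X x) + ψ x * divergence X x) = 0 := by
      refine integral_eq_zero_of_locally ho hb hX hψs fun p hp => ?_
      by_cases hpΩ : p ∈ Ω
      · obtain ⟨ρ, hρ, hρΩ⟩ := Metric.isOpen_iff.1 ho p hpΩ
        refine ⟨ρ, hρ, fun χ hχ hχc hχs => ?_⟩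
        obtain ⟨C, -, hC, -⟩ := exists_lipschitzWith_bound hχ hχc
        exact integral_fderiv_add_mul_divergence ho (hX.contDiffOn ho) hC hχc (hχs.trans hρΩ)
      · have hpf : p ∈ frontier Ω := ⟨hp.1, fun h => hpΩ (interior_subset h)⟩
        exact (hreg p ⟨hpf, fun h => disjoint_left.1 hψZ hp.2 ⟨hpf, h⟩⟩).integral_eq_zero
          ho hb hX hXn
    have hdi : IntegrableOn (divergence X) Ω := (hX.hasContExt_divergence ho).integrableOn ho hb
    have hQi := (hX.hasContExt_fderiv_add_mul_divergence ho hψs).integrableOn ho hb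
    have heq : ∫ x in Ω, divergence X x
        = ∫ x in Ω, (divergence X x - (fderiv ℝ ψ x (X x) + ψ x * divergence X x)) := by
      rw [integral_sub hdi hQi, hzero, sub_zero]
    set I : ι → E d → ℝ := fun i => (Metric.ball (c i) (2 * r i)).indicator
      (fun _ => (4 * M * M * CX + M * CD) / r i) with hI
    have hIi : ∀ i, Integrable (I i) := fun i =>
      (integrable_indicator_iff Metric.isOpen_ball.measurableSet).2
        (integrableOn_const measure_ball_lt_top.ne)
    have hI0 : ∀ i x, 0 ≤ I i x := fun i => indicator_nonneg fun _ _ => by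
      have := (hr i).1
      positivity
    have hpt : ∀ x ∈ Ω, ‖divergence X x - (fderiv ℝ ψ x (X x) + ψ x * divergence X x)‖
        ≤ ∑ i ∈ s, I i x := by
      intro x hx
      have h1 : ‖1 - ψ x‖ ≤ M * ∑ i ∈ s, (Metric.ball (c i) (2 * r i)).indicator 1 x := by
        have := hML.dist_le_mul 1 (1 - ∑ i ∈ s, b i x)
        rw [Real.smoothTransition.one, dist_eq_norm, dist_eq_norm, sub_sub_cancel,
          Real.norm_of_nonneg (Finset.sum_nonneg fun i _ => hb0 i x)] at this
        exact this.trans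
          (mul_le_mul_of_nonneg_left (Finset.sum_le_sum fun i _ => hbi i x) M.2)
      have h2 : ‖fderiv ℝ ψ x‖
          ≤ M * ∑ i ∈ s, (Metric.ball (c i) (2 * r i)).indicator (fun _ => 4 * M / r i) x := by
        have hsd : HasFDerivAt (fun y => 1 - ∑ i ∈ s, b i y) (-∑ i ∈ s, fderiv ℝ (b i) x) x :=
          (HasFDerivAt.fun_sum fun i _ =>
            ((hbs i).differentiable (by simp) x).hasFDerivAt).const_sub 1
        have hfd := (((Real.smoothTransition.contDiff (n := 1)).differentiable one_ne_zero
          _).hasDerivAt.comp_hasFDerivAt x hsd).fderiv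
        rw [Function.comp_def] at hfd
        rw [hψ, hfd, norm_smul, norm_neg]
        exact mul_le_mul (hM _) ((norm_sum_le _ _).trans (Finset.sum_le_sum fun i _ => hbd i x))
          (norm_nonneg _) M.2
      have h3 : divergence X x - (fderiv ℝ ψ x (X x) + ψ x * divergence X x)
          = (1 - ψ x) * divergence X x - fderiv ℝ ψ x (X x) := by ring
      rw [h3]
      refine (norm_sub_le _ _).trans ?_
      rw [norm_mul]
      have h4 := mul_le_mul h1 (hCD x hx) (norm_nonneg _) ((norm_nonneg _).trans h1)
      have h5 := ((fderiv ℝ ψ x).le_opNorm (X x)).trans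
        (mul_le_mul h2 (hCX x hx) (norm_nonneg _) ((norm_nonneg _).trans h2))
      refine (add_le_add h4 h5).trans ?_
      rw [Finset.mul_sum, Finset.mul_sum, Finset.sum_mul, Finset.sum_mul,
        ← Finset.sum_add_distrib]
      refine Finset.sum_le_sum fun i _ => ?_
      by_cases hxi : x ∈ Metric.ball (c i) (2 * r i)
      · simp only [hI, indicator_of_mem hxi, Pi.one_apply, mul_one]
        have hri := (hr i).1
        rw [add_div, add_comm]
        refine add_le_add (le_of_eq (by ring)) ?_
        -- The divergence term carries no `1 / r i`; the bound `r i ≤ 1` supplies it.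
        rw [le_div_iff₀ hri]
        exact mul_le_of_le_one_right (by positivity) (hr i).2
      · simp [hI, indicator_of_notMem hxi]
    rw [heq]
    refine (norm_integral_le_of_norm_le (integrable_finsetSum s fun i _ => (hIi i).restrict)
      ((ae_restrict_mem ho.measurableSet).mono hpt)).trans ?_
    rw [integral_finsetSum _ fun i _ => (hIi i).restrict]
    calc ∑ i ∈ s, ∫ x in Ω, I i x ≤ ∑ i ∈ s, B * r i ^ (d - 1) := by
          refine Finset.sum_le_sum fun i _ => ?_
          have hri := (hr i).1
          refine (setIntegral_le_integral (hIi i) (.of_forall (hI0 i))).trans_eq ?_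
          rw [hI, integral_indicator_const _ Metric.isOpen_ball.measurableSet,
            Measure.real, Measure.addHaar_ball_of_pos _ _ (by positivity), ENNReal.toReal_mul,
            ENNReal.toReal_ofReal (by positivity), finrank_euclideanSpace_fin, hB, Measure.real,
            smul_eq_mul, mul_pow]
          -- A ball volume of order `r ^ d` against a gradient of order `1 / r` leaves `r ^ (d -
          -- 1)`; the natural subtraction is genuine as `1 ≤ d`.
          obtain ⟨k, rfl⟩ : ∃ k, d = k + 1 := ⟨d - 1, by omega⟩
          rw [Nat.add_sub_cancel, pow_succ (r i)]
          field_simp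
      _ = B * ∑ i ∈ s, r i ^ (d - 1) := by rw [Finset.mul_sum]
      _ ≤ B * δ := mul_le_mul_of_nonneg_left hsum hB0
  by_contra hne
  have hpos : 0 < ‖∫ x in Ω, divergence X x‖ := norm_pos_iff.2 hne
  have := main (‖∫ x in Ω, divergence X x‖ / (2 * (B + 1))) (by positivity)
  rw [mul_div_left_comm] at this
  have h3 : B / (2 * (B + 1)) < 1 := by
    rw [div_lt_one (by positivity)]; linarith
  nlinarith

end Localization

/-! ### Enlarging the class of test fields of the weak divergence -/

section WeakDivergence

variable {d : ℕ} {Ω : Set (E d)}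

/-- Mollification of a `C¹` field with compact support in `Ω`. -/
lemma exists_smooth_approx (ho : IsOpen Ω) {X : E d → E d} (hX : ContDiff ℝ 1 X)
    (hc : HasCompactSupport X) (hs : tsupport X ⊆ Ω) {ε : ℝ} (hε : 0 < ε) :
    ∃ Y : E d → E d, ContDiff ℝ ∞ Y ∧ HasCompactSupport Y ∧ tsupport Y ⊆ Ω ∧
      ∀ x, ‖Y x - X x‖ ≤ ε ∧ ‖fderiv ℝ Y x - fderiv ℝ X x‖ ≤ ε := by
  have hX' : Continuous (fderiv ℝ X) := hX.continuous_fderiv one_ne_zero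
  obtain ⟨δ₁, hδ₁, h1⟩ := Metric.uniformContinuous_iff.1
    (hX.continuous.uniformContinuous_of_tendsto_cocompact hc.is_zero_at_infty) ε hε
  obtain ⟨δ₂, hδ₂, h2⟩ := Metric.uniformContinuous_iff.1
    (hX'.uniformContinuous_of_tendsto_cocompact (hc.fderiv (𝕜 := ℝ)).is_zero_at_infty) ε hε
  obtain ⟨δ₃, hδ₃, h3⟩ := IsCompact.exists_cthickening_subset_open hc ho hs
  -- The three scales control the field, its derivative, and the distance of the support from the
  -- complement of `Ω`.
  set δ := min δ₁ (min δ₂ δ₃) with hδ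
  have hδ0 : 0 < δ := lt_min hδ₁ (lt_min hδ₂ hδ₃)
  set φ : ContDiffBump (0 : E d) := ⟨δ / 2, δ, half_pos hδ0, half_lt_self hδ0⟩
  set Y : E d → E d :=
    convolution (φ.normed volume) X (ContinuousLinearMap.lsmul ℝ ℝ) volume with hY
  have hts : tsupport Y ⊆ Metric.cthickening δ₃ (tsupport X) := by
    refine closure_minimal ((support_convolution_subset _).trans ?_) Metric.isClosed_cthickening
    rintro _ ⟨a, ha, b, hb, rfl⟩
    rw [φ.support_normed_eq] at ha
    refine Metric.mem_cthickening_of_dist_le _ b _ _ (subset_tsupport _ hb) ?_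
    have : dist a 0 < δ := ha
    rw [dist_zero_right] at this
    rw [dist_eq_norm, add_sub_cancel_right]
    exact this.le.trans ((min_le_right _ _).trans (min_le_right _ _))
  have hYc : HasCompactSupport Y := φ.hasCompactSupport_normed.convolution _ hc
  refine ⟨Y, φ.hasCompactSupport_normed.contDiff_convolution_left _ φ.contDiff_normed
    (hX.continuous.locallyIntegrable (μ := volume)), hYc, hts.trans h3, fun x => ⟨?_, ?_⟩⟩
  · rw [← dist_eq_norm]
    refine φ.dist_normed_convolution_le hX.continuous.aestronglyMeasurable fun y hy => ?_
    exact (h1 (lt_of_lt_of_le hy (min_le_left _ _))).le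
  · have hd := (hc.hasFDerivAt_convolution_right (ContinuousLinearMap.lsmul ℝ ℝ)
      ((φ.continuous_normed (μ := volume)).locallyIntegrable (μ := volume)) hX x).fderiv
    have hd' : fderiv ℝ Y x = convolution (φ.normed volume) (fderiv ℝ X)
        (ContinuousLinearMap.lsmul ℝ ℝ) volume x := hd
    rw [hd', ← dist_eq_norm]
    refine φ.dist_normed_convolution_le hX'.aestronglyMeasurable fun y hy => ?_
    exact (h2 (lt_of_lt_of_le hy ((min_le_right _ _).trans (min_le_left _ _)))).le

lemma frob_jacobian_eq {M : Matrix (Fin d) (Fin d) ℝ} {X : E d → E d} {x : E d}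
    (hX : DifferentiableAt ℝ X x) :
    frob M (jacobian X x) = ∑ i, ∑ j, M i j * fderiv ℝ X x (EuclideanSpace.single j 1) i := by
  simp only [frob, jacobian_apply hX]

/-- The defining identity of the weak divergence passes to dominated pointwise limits. -/
lemma integral_inner_eq_of_tendsto (ho : IsOpen Ω) {M : E d → Matrix (Fin d) (Fin d) ℝ}
    {D : E d → E d} (hD : IntegrableOn D Ω) (hM : ∀ i j, IntegrableOn (fun x => M x i j) Ω)
    {Y : ℕ → E d → E d} {X : E d → E d} (hY : ∀ n, ContDiff ℝ 1 (Y n)) {C : ℝ}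
    (hC : ∀ n, ∀ x ∈ Ω, ‖Y n x‖ ≤ C ∧ ‖fderiv ℝ (Y n) x‖ ≤ C)
    (hX : ∀ x ∈ Ω, DifferentiableAt ℝ X x)
    (hlim : ∀ᵐ x ∂(volume.restrict Ω), Tendsto (fun n => Y n x) atTop (𝓝 (X x)) ∧
      Tendsto (fun n => fderiv ℝ (Y n) x) atTop (𝓝 (fderiv ℝ X x)))
    (heq : ∀ n, ∫ x in Ω, inner ℝ (D x) (Y n x) = - ∫ x in Ω, frob (M x) (jacobian (Y n) x)) :
    ∫ x in Ω, inner ℝ (D x) (X x) = - ∫ x in Ω, frob (M x) (jacobian X x) := by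
  have hYd : ∀ n x, DifferentiableAt ℝ (Y n) x := fun n x => (hY n).differentiable one_ne_zero x
  have hcoord : ∀ (A : E d →L[ℝ] E d) (i j : Fin d),
      ‖A (EuclideanSpace.single j 1) i‖ ≤ ‖A‖ := fun A i j => by
    refine (PiLp.norm_apply_le _ i).trans ((A.le_opNorm _).trans ?_)
    simp
  have hcont : ∀ i j : Fin d, Continuous fun A : E d →L[ℝ] E d =>
      A (EuclideanSpace.single j 1) i := fun i j =>
    (EuclideanSpace.proj (𝕜 := ℝ) i).continuous.comp (ContinuousLinearMap.apply ℝ (E d)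
      (EuclideanSpace.single j (1 : ℝ))).continuous
  have h1 : Tendsto (fun n => ∫ x in Ω, inner ℝ (D x) (Y n x)) atTop
      (𝓝 (∫ x in Ω, inner ℝ (D x) (X x))) := by
    refine tendsto_integral_of_dominated_convergence (fun x => ‖D x‖ * C)
      (fun n => hD.aestronglyMeasurable.inner (hY n).continuous.aestronglyMeasurable)
      (hD.norm.mul_const C) (fun n => ?_) ?_
    · filter_upwards [ae_restrict_mem ho.measurableSet] with x hx
      exact (norm_inner_le_norm _ _).trans
        (mul_le_mul_of_nonneg_left (hC n x hx).1 (norm_nonneg _))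
    · filter_upwards [hlim] with x hx
      exact tendsto_const_nhds.inner hx.1
  have h2 : Tendsto (fun n => ∫ x in Ω, frob (M x) (jacobian (Y n) x)) atTop
      (𝓝 (∫ x in Ω, frob (M x) (jacobian X x))) := by
    refine tendsto_integral_of_dominated_convergence (fun x => ∑ i, ∑ j, ‖M x i j‖ * C)
      (fun n => ?_) (integrable_finsetSum _ fun i _ => integrable_finsetSum _ fun j _ =>
        (hM i j).norm.mul_const C) (fun n => ?_) ?_
    · simp only [frob_jacobian_eq (hYd n _)]
      exact Finset.aestronglyMeasurable_fun_sum _ fun i _ =>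
        Finset.aestronglyMeasurable_fun_sum _ fun j _ => (hM i j).aestronglyMeasurable.mul
          ((hcont i j).comp ((hY n).continuous_fderiv one_ne_zero)).aestronglyMeasurable
    · filter_upwards [ae_restrict_mem ho.measurableSet] with x hx
      rw [frob_jacobian_eq (hYd n _)]
      refine norm_sum_le_of_le _ fun i _ => norm_sum_le_of_le _ fun j _ => ?_
      rw [norm_mul]
      exact mul_le_mul_of_nonneg_left ((hcoord _ i j).trans (hC n x hx).2) (norm_nonneg _)
    · filter_upwards [hlim, ae_restrict_mem ho.measurableSet] with x hx hxΩ
      simp only [frob_jacobian_eq (hYd _ _), frob_jacobian_eq (hX x hxΩ)]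
      exact tendsto_finsetSum _ fun i _ => tendsto_finsetSum _ fun j _ =>
        (((hcont i j).tendsto _).comp hx.2).const_mul _
  exact tendsto_nhds_unique h1 ((h2.neg).congr fun n => (heq n).symm)

/-- Mollification converges uniformly together with first derivatives, and these are all that the
identity involves. -/
lemma IsWeakTensorDivergence.integral_eq_of_contDiff_one (ho : IsOpen Ω)
    {M : E d → Matrix (Fin d) (Fin d) ℝ} {D : E d → E d} (hMD : IsWeakTensorDivergence Ω M D)
    (hD : IntegrableOn D Ω) (hM : ∀ i j, IntegrableOn (fun x => M x i j) Ω)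
    {X : E d → E d} (hX : ContDiff ℝ 1 X) (hc : HasCompactSupport X) (hs : tsupport X ⊆ Ω) :
    ∫ x in Ω, inner ℝ (D x) (X x) = - ∫ x in Ω, frob (M x) (jacobian X x) := by
  choose Y hY hYc hYs hYX using fun n : ℕ =>
    exists_smooth_approx ho hX hc hs (Nat.one_div_pos_of_nat (α := ℝ) (n := n))
  obtain ⟨C₁, hC₁⟩ := hX.continuous.bounded_above_of_compact_support hc
  obtain ⟨C₂, hC₂⟩ := (hX.continuous_fderiv one_ne_zero).bounded_above_of_compact_support
    (hc.fderiv (𝕜 := ℝ))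
  have hle : ∀ n : ℕ, 1 / ((n : ℝ) + 1) ≤ 1 := fun n => by
    rw [div_le_one (by positivity)]
    linarith [n.cast_nonneg (α := ℝ)]
  refine integral_inner_eq_of_tendsto ho hD hM (fun n => (hY n).of_le (by exact_mod_cast le_top))
    (C := max C₁ C₂ + 1) (fun n x _ => ⟨?_, ?_⟩) (fun x _ => hX.differentiable one_ne_zero x)
    (.of_forall fun x => ⟨?_, ?_⟩) fun n => hMD.integral_eq _ (hY n) (hYc n) (hYs n)
  · have := norm_le_norm_add_norm_sub' (Y n x) (X x)
    linarith [hYX n x, hle n, hC₁ x, le_max_left C₁ C₂]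
  · have := norm_le_norm_add_norm_sub' (fderiv ℝ (Y n) x) (fderiv ℝ X x)
    linarith [hYX n x, hle n, hC₂ x, le_max_right C₁ C₂]
  · exact tendsto_iff_norm_sub_tendsto_zero.2 (squeeze_zero (fun _ => norm_nonneg _)
      (fun n => (hYX n x).1) tendsto_one_div_add_atTop_nhds_zero_nat)
  · exact tendsto_iff_norm_sub_tendsto_zero.2 (squeeze_zero (fun _ => norm_nonneg _)
      (fun n => (hYX n x).2) tendsto_one_div_add_atTop_nhds_zero_nat)

/-- The derivative of a differentiable field vanishes almost everywhere on its zero set. -/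
lemma ae_fderiv_eq_zero_of_eq_zero (ho : IsOpen Ω) {v : E d → E d}
    (hv : ∀ x ∈ Ω, DifferentiableAt ℝ v x) :
    ∀ᵐ x ∂(volume.restrict Ω), v x = 0 → fderiv ℝ v x = 0 := by
  have hcont : ContinuousOn v Ω := fun x hx => (hv x hx).continuousAt.continuousWithinAt
  have hsm : MeasurableSet {x ∈ Ω | v x = 0} := by
    obtain ⟨u, hu, huv⟩ := (continuousOn_iff_isClosed.1 hcont) {0} isClosed_singleton
    have : {x ∈ Ω | v x = 0} = u ∩ Ω := by
      rw [← huv]; ext x; simp [and_comm]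
    rw [this]
    exact hu.measurableSet.inter ho.measurableSet
  -- On its zero set `v` is approximated by the zero map with constant `0`; at almost every point of
  -- the set this forces the full derivative to be `0`.
  have happ : ApproximatesLinearOn v (0 : E d →L[ℝ] E d) {x ∈ Ω | v x = 0} 0 := by
    rintro x ⟨-, hx⟩ y ⟨-, hy⟩
    simp [hx, hy]
  have := happ.norm_fderiv_sub_le volume hsm (fderiv ℝ v)
    fun x hx => (hv x hx.1).hasFDerivAt.hasFDerivWithinAt
  rw [ae_restrict_iff' hsm] at this
  rw [ae_restrict_iff' ho.measurableSet]
  filter_upwards [this] with x hx hxΩ hx0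
  simpa using hx ⟨hxΩ, hx0⟩

/-- The defining identity of the weak divergence holds for all test fields of class `C¹(closure Ω)`
that vanish on the boundary. -/
theorem IsWeakTensorDivergence.integral_eq_of_frontier_eq_zero (ho : IsOpen Ω)
    (hb : Bornology.IsBounded Ω)
    {M : E d → Matrix (Fin d) (Fin d) ℝ} {D : E d → E d} (hMD : IsWeakTensorDivergence Ω M D)
    (hD : IntegrableOn D Ω) (hM : ∀ i j, IntegrableOn (fun x => M x i j) Ω)
    {v : E d → E d} (hv : IsC1Closure Ω v) (hv0 : ∀ x ∈ frontier Ω, v x = 0) :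
    ∫ x in Ω, inner ℝ (D x) (v x) = - ∫ x in Ω, frob (M x) (jacobian v x) := by
  obtain ⟨B, hB, hB2, -⟩ := exists_bound_deriv_smoothTransition
  set w : E d → E d := Ω.indicator v with hw
  have hwc : Continuous w := continuous_indicator hv0 hv.1
  have hwv : ∀ x ∈ Ω, w =ᶠ[𝓝 x] v := fun x hx => by
    filter_upwards [ho.mem_nhds hx] with y hy using indicator_of_mem hy v
  -- Truncation by values: `X k` vanishes where `|w| ≤ 1 / k` and equals `w` where `k² |w|² ≥ 2`.
  -- Continuity of `w`, due to `v = 0` on the boundary, gives supports inside `Ω`.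
  set X : ℕ → E d → E d :=
    fun k x => Real.smoothTransition ((k : ℝ) ^ 2 * ‖w x‖ ^ 2 - 1) • w x with hX
  have hXd : ∀ k, ContDiff ℝ 1 (X k) := by
    refine fun k => contDiff_of_contDiffOn_of_eventually_eq_zero ho ?_ fun x hx => ?_
    · have h1 : ContDiffOn ℝ 1 w Ω := (hv.contDiffOn ho).congr fun x hx => indicator_of_mem hx v
      exact ((Real.smoothTransition.contDiff (n := 1)).comp_contDiffOn
        ((contDiffOn_const.mul (h1.norm_sq ℝ)).sub contDiffOn_const)).smul h1
    · have h1 : Continuous fun y => (k : ℝ) ^ 2 * ‖w y‖ ^ 2 := by fun_prop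
      have h2 : (k : ℝ) ^ 2 * ‖w x‖ ^ 2 < 1 := by simp [hw, indicator_of_notMem hx]
      filter_upwards [h1.continuousAt.eventually_lt continuousAt_const h2] with y hy
      simp only [hX]
      rw [Real.smoothTransition.zero_of_nonpos (by linarith), zero_smul, Pi.zero_apply]
  have hXs : ∀ k, tsupport (X k) ⊆ Ω := by
    intro k
    have h1 : tsupport (X k) ⊆ {x | 1 ≤ (k : ℝ) ^ 2 * ‖w x‖ ^ 2} := by
      refine closure_minimal (fun x hx => ?_) (isClosed_le continuous_const (by fun_prop))
      by_contra hlt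
      refine hx ?_
      simp only [hX]
      rw [Real.smoothTransition.zero_of_nonpos (by simp at hlt; linarith), zero_smul]
    refine h1.trans fun x hx => ?_
    by_contra hxΩ
    simp [hw, indicator_of_notMem hxΩ] at hx
    linarith
  have hXc : ∀ k, HasCompactSupport (X k) := fun k =>
    Metric.isCompact_of_isClosed_isBounded (isClosed_tsupport _) (hb.subset (hXs k))
  set q : ℕ → E d → ℝ := fun k x => (k : ℝ) ^ 2 * ‖v x‖ ^ 2 with hq
  have hfd : ∀ k, ∀ x ∈ Ω, fderiv ℝ (X k) x
      = Real.smoothTransition (q k x - 1) • fderiv ℝ v x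
        + (deriv Real.smoothTransition (q k x - 1) • ((k : ℝ) ^ 2 •
            (2 • (innerSL ℝ (v x)).comp (fderiv ℝ v x)))).smulRight (v x) := by
    intro k x hx
    have hvd := hv.hasFDerivAt ho hx
    have h1 : HasFDerivAt (fun y => Real.smoothTransition ((k : ℝ) ^ 2 * ‖v y‖ ^ 2 - 1))
        (deriv Real.smoothTransition (q k x - 1) • ((k : ℝ) ^ 2 •
            (2 • (innerSL ℝ (v x)).comp (fderiv ℝ v x)))) x :=
      ((Real.smoothTransition.contDiff (n := 1)).differentiable one_ne_zero
        _).hasDerivAt.comp_hasFDerivAt x ((hvd.norm_sq.const_mul _).sub_const 1)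
    have h2 : X k =ᶠ[𝓝 x] (fun y => Real.smoothTransition ((k : ℝ) ^ 2 * ‖v y‖ ^ 2 - 1)) • v := by
      filter_upwards [hwv x hx] with y hy
      simp [hX, hy]
    rw [h2.fderiv_eq]
    exact (h1.smul hvd).fderiv
  obtain ⟨C₁, -, hC₁⟩ := hv.hasContExt.exists_bound hb
  obtain ⟨C₂, hC₂0, hC₂⟩ := hv.hasContExt_fderiv.exists_bound hb
  refine integral_inner_eq_of_tendsto ho hD hM hXd (C := max C₁ (C₂ * (1 + 4 * B)))
    (fun k x hx => ⟨?_, ?_⟩) (fun x hx => hv.differentiableAt ho hx) ?_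
    fun k => hMD.integral_eq_of_contDiff_one ho hD hM (hXd k) (hXc k) (hXs k)
  · refine le_trans ?_ ((hC₁ x hx).trans (le_max_left _ _))
    simp only [hX]
    rw [(hwv x hx).eq_of_nhds, norm_smul, Real.norm_of_nonneg (Real.smoothTransition.nonneg _)]
    exact mul_le_of_le_one_left (norm_nonneg _) (Real.smoothTransition.le_one _)
  · refine le_trans ?_ (le_max_right _ _)
    rw [hfd k x hx]
    have h1 : ‖Real.smoothTransition (q k x - 1) • fderiv ℝ v x‖ ≤ C₂ := by
      rw [norm_smul, Real.norm_of_nonneg (Real.smoothTransition.nonneg _)]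
      exact (mul_le_of_le_one_left (norm_nonneg _) (Real.smoothTransition.le_one _)).trans
        (hC₂ x hx)
    -- The gradient of the truncation contributes `k² |v|²` times `∇v`; the step has nonzero slope
    -- only where `q ≤ 2`, hence a bound uniform in `k`.
    have h2 : ‖deriv Real.smoothTransition (q k x - 1)‖ * q k x ≤ B * 2 := by
      by_cases hm : q k x - 1 ∈ Icc (0 : ℝ) 1
      · exact mul_le_mul (hB _) (by linarith [hm.2]) (by positivity) B.2
      · rw [hB2 _ hm, norm_zero, zero_mul]; positivity
    have h3 : ‖(deriv Real.smoothTransition (q k x - 1) • ((k : ℝ) ^ 2 •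
        (2 • (innerSL ℝ (v x)).comp (fderiv ℝ v x)))).smulRight (v x)‖ ≤ C₂ * (4 * B) := by
      rw [ContinuousLinearMap.norm_smulRight_apply, norm_smul, norm_smul,
        ← Nat.cast_smul_eq_nsmul ℝ, norm_smul]
      have h4 : ‖(innerSL ℝ (v x)).comp (fderiv ℝ v x)‖ ≤ ‖v x‖ * C₂ :=
        (ContinuousLinearMap.opNorm_comp_le _ _).trans (by
          rw [innerSL_apply_norm]
          exact mul_le_mul_of_nonneg_left (hC₂ x hx) (norm_nonneg _))
      rw [Real.norm_of_nonneg (sq_nonneg (k : ℝ))]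
      calc ‖deriv Real.smoothTransition (q k x - 1)‖ * ((k : ℝ) ^ 2 * (‖((2 : ℕ) : ℝ)‖ *
            ‖(innerSL ℝ (v x)).comp (fderiv ℝ v x)‖)) * ‖v x‖
          ≤ ‖deriv Real.smoothTransition (q k x - 1)‖ * ((k : ℝ) ^ 2 * (2 *
            (‖v x‖ * C₂))) * ‖v x‖ := by
            gcongr
            simp
        _ = (‖deriv Real.smoothTransition (q k x - 1)‖ * q k x) * (2 * C₂) := by
            simp only [hq]; ring
        _ ≤ (B * 2) * (2 * C₂) := mul_le_mul_of_nonneg_right h2 (by positivity)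
        _ = C₂ * (4 * B) := by ring
    refine (norm_add_le _ _).trans ((add_le_add h1 h3).trans_eq (by ring))
  · filter_upwards [ae_restrict_mem ho.measurableSet,
      ae_fderiv_eq_zero_of_eq_zero ho fun x hx => hv.differentiableAt ho hx] with x hx hx0
    -- Where `v = 0` the derivatives of `X k` vanish for all `k`, so the limit is right only because
    -- `∇v = 0` almost everywhere there.
    by_cases hvx : v x = 0
    · constructor
      · simp [hX, (hwv x hx).eq_of_nhds, hvx]
      · refine tendsto_const_nhds.congr fun k => ?_
        ext1 y
        simp [hfd k x hx, hx0 hvx, hvx]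
    · have hev : ∀ᶠ k : ℕ in atTop, 2 < q k x := by
        have h1 : Tendsto (fun k : ℕ => q k x) atTop atTop :=
          ((tendsto_pow_atTop two_ne_zero).comp tendsto_natCast_atTop_atTop).atTop_mul_const
            (by positivity)
        exact h1.eventually_gt_atTop 2
      constructor
      · refine tendsto_const_nhds.congr' ?_
        filter_upwards [hev] with k hk
        simp only [hX, (hwv x hx).eq_of_nhds]
        rw [Real.smoothTransition.one_of_one_le (by simp only [hq] at hk; linarith), one_smul]
      · refine tendsto_const_nhds.congr' ?_
        filter_upwards [hev] with k hk
        rw [hfd k x hx, Real.smoothTransition.one_of_one_le (by linarith),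
          hB2 _ fun hm => by linarith [hm.2]]
        simp

end WeakDivergence

/-! ### The energy balance of one time step -/

section OneStep

variable {d : ℕ} {Ω : Set (E d)}

lemma IsC1Closure.mean (ho : IsOpen Ω) {u v : E d → ℝ} (hu : IsC1Closure Ω u)
    (hv : IsC1Closure Ω v) : IsC1Closure Ω (fun x => (v x + u x) / 2) := by
  have := (hv.add ho hu).const_smul ho (1 / 2)
  simpa [div_eq_inv_mul] using this

lemma hasFDerivAt_norm_sq {u : E d → E d} {x : E d} (hu : DifferentiableAt ℝ u x) :
    HasFDerivAt (fun y => ‖u y‖ ^ 2) ((2 : ℝ) • (innerSL ℝ (u x)).comp (fderiv ℝ u x)) x := by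
  have := hu.hasFDerivAt.norm_sq
  rwa [← Nat.cast_smul_eq_nsmul ℝ] at this

lemma IsC1Closure.norm_sq (ho : IsOpen Ω) {u : E d → E d} (hu : IsC1Closure Ω u) :
    IsC1Closure Ω (fun x => ‖u x‖ ^ 2) :=
  .of_hasFDerivAt (hu.1.norm.pow 2) (fun _ hx => hasFDerivAt_norm_sq (hu.differentiableAt ho hx))
    ((hu.hasContExt.comp₂
      (Φ := fun p : E d × (E d →L[ℝ] E d) => (innerSL ℝ p.1).comp p.2)
      (((innerSL ℝ).continuous.comp continuous_fst).clm_comp continuous_snd)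
      hu.hasContExt_fderiv).const_smul 2)

lemma pderiv_mul {a b : E d → ℝ} {x : E d} (ha : DifferentiableAt ℝ a x)
    (hb : DifferentiableAt ℝ b x) (j : Fin d) :
    pderiv j (fun y => a y * b y) x = a x * pderiv j b x + pderiv j a x * b x := by
  simp [pderiv, fderiv_fun_mul ha hb, mul_comm]

lemma differentiableAt_coord {u : E d → E d} {x : E d} (hu : DifferentiableAt ℝ u x)
    (i : Fin d) : DifferentiableAt ℝ (fun y => u y i) x :=
  (EuclideanSpace.proj (𝕜 := ℝ) i).differentiableAt.comp x hu

lemma tensorDivergence_smul_tensor {a : E d → ℝ} {u : E d → E d} {x : E d}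
    (ha : DifferentiableAt ℝ a x) (hu : DifferentiableAt ℝ u x) :
    tensorDivergence (fun y => a y • tensor (u y) (u y)) x
      = divergence (fun y => a y • u y) x • u x + a x • fderiv ℝ u x (u x) := by
  have hau : DifferentiableAt ℝ (fun y => a y • u y) x := ha.smul hu
  ext i
  have h1 : ∀ j, pderiv j (fun y => (a y • tensor (u y) (u y)) i j) x
      = u x i * pderiv j (fun y => (a y • u y) j) x
        + a x * (u x j * fderiv ℝ u x (EuclideanSpace.single j 1) i) := by
    intro j
    have : (fun y => (a y • tensor (u y) (u y)) i j) = fun y => u y i * (a y • u y) j := by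
      funext y
      simp [tensor]
      ring
    rw [this, pderiv_mul (differentiableAt_coord hu i) (differentiableAt_coord hau j),
      pderiv_apply hu i j]
    simp
    ring
  rw [map_eq_sum_coord (fderiv ℝ u x) (u x)]
  simp only [tensorDivergence, h1, Finset.sum_add_distrib, ← Finset.mul_sum, divergence,
    PiLp.add_apply, PiLp.smul_apply, smul_eq_mul, WithLp.ofLp_sum, Finset.sum_apply]
  ring

/-- The right-hand side is what the two correction terms of the momentum equation subtract, so
convection does no work. -/
lemma inner_tensorDivergence {a : E d → ℝ} {u : E d → E d} {x : E d}
    (ha : DifferentiableAt ℝ a x) (hu : DifferentiableAt ℝ u x) :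
    inner ℝ (tensorDivergence (fun y => a y • tensor (u y) (u y)) x) (u x)
      = divergence (fun y => a y • u y) x * ‖u x‖ ^ 2
        + 1 / 2 * a x * inner ℝ (gradient (fun y => ‖u y‖ ^ 2) x) (u x) := by
  rw [tensorDivergence_smul_tensor ha hu, inner_gradient, (hasFDerivAt_norm_sq hu).fderiv,
    inner_add_left, real_inner_smul_left, real_inner_smul_left, real_inner_self_eq_norm_sq,
    real_inner_comm]
  simp
  ring

variable {f : ℝ → ℝ → ℝ} {S : ℝ → Matrix (Fin d) (Fin d) ℝ → Matrix (Fin d) (Fin d) ℝ}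
  {γ η Δt : ℝ} {U V : Fields d}

lemma Fields.IsAdmissible.integrableOn_energyDensity (ho : IsOpen Ω) (hb : Bornology.IsBounded Ω)
    (hU : U.IsAdmissible Ω) (hF : IntegrableOn (fun x => U.ρ x * f (U.ρ x) (U.φ x)) Ω) :
    IntegrableOn (energyDensity f γ U) Ω :=
  (hF.add (((hU.c1_ρ.hasContExt.const_mul (1 / 2)).mul
    hU.c1_v.hasContExt.norm_sq).integrableOn ho hb)).add
      ((hU.c1_σ.hasContExt.norm_sq.const_mul (γ / 2)).integrableOn ho hb)

/-- The increment of the potential part of the energy density. -/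
lemma IsTimeStep.free_energy_sub {W : Fields d} (hst : IsTimeStep Ω f S γ η Δt U V W) {x : E d}
    (hx : x ∈ Ω) :
    V.ρ x * f (V.ρ x) (V.φ x) - U.ρ x * f (U.ρ x) (U.φ x)
      = (V.φ x - U.φ x) * (W.μ x + γ * divergence W.σ x)
        + (V.ρ x - U.ρ x) * (W.τ x - 1 / 4 * (‖V.v x‖ ^ 2 + ‖U.v x‖ ^ 2)) := by
  have h1 : (V.φ x - U.φ x) * (W.μ x + γ * divergence W.σ x)
      = (V.ρ x * f (V.ρ x) (V.φ x) - V.ρ x * f (V.ρ x) (U.φ x)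
          + U.ρ x * f (U.ρ x) (V.φ x) - U.ρ x * f (U.ρ x) (U.φ x)) / 2 := by
    -- Where the increment vanishes both sides are zero, so no convention for the quotient is
    -- needed.
    by_cases h : V.φ x = U.φ x
    · rw [h]; ring
    · have h0 : V.φ x - U.φ x ≠ 0 := sub_ne_zero.2 h
      have := hst.potential x hx h
      field_simp at this
      linarith
  have h2 : (V.ρ x - U.ρ x) * (W.τ x - 1 / 4 * (‖V.v x‖ ^ 2 + ‖U.v x‖ ^ 2))
      = (V.ρ x * f (V.ρ x) (V.φ x) - U.ρ x * f (U.ρ x) (V.φ x)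
          + V.ρ x * f (V.ρ x) (U.φ x) - U.ρ x * f (U.ρ x) (U.φ x)) / 2 := by
    by_cases h : V.ρ x = U.ρ x
    · rw [h]; ring
    · have h0 : V.ρ x - U.ρ x ≠ 0 := sub_ne_zero.2 h
      have := hst.auxiliary x hx h
      field_simp at this
      linarith
  rw [h1, h2]
  ring

/-- Test mass with `τ`, momentum with `v` and phase with `μ`, all at the midpoint. Integrability of
the potential part at the new level is included because the next step needs it. -/
theorem IsTimeStep.energy_balance (hd : 1 ≤ d) (hΩ : IsAdmissibleDomain Ω)
    (hS : Continuous fun p : ℝ × Matrix (Fin d) (Fin d) ℝ => S p.1 p.2)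
    (hΔt : 0 < Δt) (hU : U.IsAdmissible Ω) (hV : V.IsAdmissible Ω)
    (hσ : ∀ x ∈ Ω, U.σ x = gradient U.φ x)
    (hst : IsTimeStep Ω f S γ η Δt U V (U.mid V))
    (hF : IntegrableOn (fun x => U.ρ x * f (U.ρ x) (U.φ x)) Ω) :
    IntegrableOn (fun x => V.ρ x * f (V.ρ x) (V.φ x)) Ω ∧
    IntegrableOn (dissipationDensity S η (U.mid V)) Ω ∧
    ∫ x in Ω, energyDensity f γ V x = (∫ x in Ω, energyDensity f γ U x)
      - Δt * ∫ x in Ω, dissipationDensity S η (U.mid V) x := by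
  have ho := hΩ.isOpen
  have hb := hΩ.isBounded
  set W := U.mid V with hW
  have hρ : IsC1Closure Ω W.ρ := hU.c1_ρ.mean ho hV.c1_ρ
  have hv : IsC1Closure Ω W.v := (hV.c1_v.add ho hU.c1_v).const_smul ho _
  have hφ : IsC1Closure Ω W.φ := hU.c1_φ.mean ho hV.c1_φ
  have hμ : IsC1Closure Ω W.μ := hU.c1_μ.mean ho hV.c1_μ
  have hτ : IsC1Closure Ω W.τ := hU.c1_τ.mean ho hV.c1_τ
  have hs : IsC1Closure Ω W.σ := (hV.c1_σ.add ho hU.c1_σ).const_smul ho _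
  have hδφ : IsC1Closure Ω (fun x => V.φ x - U.φ x) := hV.c1_φ.sub ho hU.c1_φ
  have hρv : IsC1Closure Ω (fun x => W.ρ x • W.v x) := hρ.smul ho hv
  have hv0 : ∀ x ∈ frontier Ω, W.v x = 0 := fun x hx => by
    simp [hW, Fields.mid, hU.v_boundary x hx, hV.v_boundary x hx]
  obtain ⟨D, hMD, hmom⟩ := hst.momentum
  have hMe : HasContExt Ω (fun x => S (W.φ x) (jacobian W.v x)) :=
    hφ.hasContExt.comp₂ hS (hv.hasContExt_jacobian ho)
  have hfrob : HasContExt Ω (fun x => frob (S (W.φ x) (jacobian W.v x)) (jacobian W.v x)) :=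
    hasContExt_frob hMe (hv.hasContExt_jacobian ho)
  -- The density may vanish on the boundary; the phase equation rewrites the quotient without
  -- division by it.
  have hdiss : HasContExt Ω (fun x => η * (|W.μ x| ^ 2 / W.ρ x)) := by
    refine (hμ.hasContExt.mul ((hδφ.hasContExt.div_const Δt).add
      (hφ.hasContExt_gradient.inner hv.hasContExt))).const_mul (-1) |>.congr fun x hx => ?_
    have := hst.phase x hx
    simp only [sq_abs]
    linear_combination (-W.μ x) * this
  -- The momentum equation expresses `D` by first derivatives of the unknowns, so this weak
  -- divergence is bounded.
  have hDe : ∃ G : E d → E d, HasContExt Ω G ∧ D =ᵐ[volume.restrict Ω] G := by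
    refine ⟨_, ((((((hρ.hasContExt.smul ((hV.c1_v.hasContExt.sub
      hU.c1_v.hasContExt).const_smul (1 / Δt))).add
      (((hρv.hasContExt_divergence ho).smul hv.hasContExt).add
        (hρ.hasContExt.smul (hv.hasContExt_fderiv.clm_apply hv.hasContExt)))).sub
      ((hρv.hasContExt_divergence ho).smul hv.hasContExt)).sub
      ((hρ.hasContExt.const_mul (1 / 2)).smul (hv.norm_sq ho).hasContExt_gradient)).add
      (hρ.hasContExt.smul hτ.hasContExt_gradient)).sub
      (hμ.hasContExt.smul hφ.hasContExt_gradient)), ?_⟩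
    filter_upwards [hmom, ae_restrict_mem ho.measurableSet] with x hx hxΩ
    rw [tensorDivergence_smul_tensor (hρ.differentiableAt ho hxΩ)
      (hv.differentiableAt ho hxΩ)] at hx
    exact (sub_eq_zero.1 hx.symm).symm
  obtain ⟨G, hG, hDG⟩ := hDe
  have hDi : IntegrableOn D Ω := (hG.integrableOn ho hb).congr hDG.symm
  have hDvi : IntegrableOn (fun x => inner ℝ (D x) (W.v x)) Ω := by
    refine ((hG.inner hv.hasContExt).integrableOn ho hb).congr ?_
    filter_upwards [hDG] with x hx
    rw [hx]
  have hMi : ∀ i j, IntegrableOn (fun x => S (W.φ x) (jacobian W.v x) i j) Ω := fun i j =>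
    (hMe.comp (Φ := fun A : Matrix (Fin d) (Fin d) ℝ => A i j)
      (continuous_id.matrix_elem i j)).integrableOn ho hb
  have hstress := hMD.integral_eq_of_frontier_eq_zero ho hb hDi hMi hv hv0
  -- the two divergence terms
  have hX₁ : IsC1Closure Ω (fun x => (V.φ x - U.φ x) • W.σ x) := hδφ.smul ho hs
  have hX₂ : IsC1Closure Ω (fun x => W.τ x • (W.ρ x • W.v x)) := hτ.smul ho hρv
  have hI₁ := hΩ.integral_divergence_eq_zero hd hX₁ fun x hx n hn => by
    simp only [hW, Fields.mid, real_inner_smul_left, inner_add_left, hU.σ_boundary x hx n hn,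
      hV.σ_boundary x hx n hn]
    simp
  have hI₂ := hΩ.integral_divergence_eq_zero hd hX₂ fun x hx n hn => by simp [hv0 x hx]
  have hi₁ := (hX₁.hasContExt_divergence ho).integrableOn ho hb
  have hi₂ := (hX₂.hasContExt_divergence ho).integrableOn ho hb
  have hFV : IntegrableOn (fun x => V.ρ x * f (V.ρ x) (V.φ x)) Ω := by
    have h1 := ((hδφ.hasContExt.mul (hμ.hasContExt.add
      ((hs.hasContExt_divergence ho).const_mul γ))).add
      ((hV.c1_ρ.hasContExt.sub hU.c1_ρ.hasContExt).mul (hτ.hasContExt.sub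
        ((hV.c1_v.hasContExt.norm_sq.add hU.c1_v.hasContExt.norm_sq).const_mul
          (1 / 4))))).integrableOn ho hb
    refine (hF.add h1).congr_fun (fun x hx => ?_) ho.measurableSet
    simp only [Pi.add_apply]
    linarith [hst.free_energy_sub hx]
  have hpt : ∀ᵐ x ∂(volume.restrict Ω), energyDensity f γ V x - energyDensity f γ U x
      = γ * divergence (fun x => (V.φ x - U.φ x) • W.σ x) x
        - Δt * (η * (|W.μ x| ^ 2 / W.ρ x) + divergence (fun x => W.τ x • (W.ρ x • W.v x)) x
          - inner ℝ (D x) (W.v x)) := by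
    filter_upwards [hmom, ae_restrict_mem ho.measurableSet] with x hx hxΩ
    have hE := hst.free_energy_sub hxΩ
    have hmass : V.ρ x - U.ρ x = -(Δt * divergence (fun y => W.ρ y • W.v y) x) := by
      have := hst.mass x hxΩ
      field_simp at this
      linarith
    have hphase : V.φ x - U.φ x
        = -(Δt * (inner ℝ (gradient W.φ x) (W.v x) + η * (W.μ x / W.ρ x))) := by
      have h1 := hst.phase x hxΩ
      have h2 : (V.φ x - U.φ x) / Δt
          = -(inner ℝ (gradient W.φ x) (W.v x) + η * (W.μ x / W.ρ x)) := by linarith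
      rw [div_eq_iff hΔt.ne'] at h2
      rw [h2]
      ring
    have hΔv : inner ℝ (V.v x - U.v x) (W.v x) = 1 / 2 * (‖V.v x‖ ^ 2 - ‖U.v x‖ ^ 2) := by
      simp only [hW, Fields.mid, real_inner_smul_right, inner_add_right, inner_sub_left,
        real_inner_self_eq_norm_sq, real_inner_comm (U.v x) (V.v x)]
      ring
    -- Both levels satisfy `σ = ∇φ`, so the midpoint value turns the product into a difference of
    -- squares.
    have hΔσ : fderiv ℝ (fun y => V.φ y - U.φ y) x (W.σ x)
        = 1 / 2 * (‖V.σ x‖ ^ 2 - ‖U.σ x‖ ^ 2) := by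
      rw [fderiv_fun_sub (hV.c1_φ.differentiableAt ho hxΩ) (hU.c1_φ.differentiableAt ho hxΩ)]
      rw [sub_apply, ← inner_gradient, ← inner_gradient, ← hσ x hxΩ,
        ← sub_eq_zero.1 (hst.gradient_eq x hxΩ).symm]
      simp only [hW, Fields.mid, real_inner_smul_right, inner_add_right,
        real_inner_self_eq_norm_sq, real_inner_comm (U.σ x) (V.σ x)]
      ring
    have hmomv := congrArg (fun w => inner ℝ w (W.v x)) hx
    simp only [inner_zero_left, inner_sub_left, inner_add_left, real_inner_smul_left,
      inner_tensorDivergence (hρ.differentiableAt ho hxΩ) (hv.differentiableAt ho hxΩ),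
      real_inner_self_eq_norm_sq] at hmomv
    rw [← inner_sub_left, hΔv] at hmomv
    have hmom' : W.ρ x * (1 / 2 * (‖V.v x‖ ^ 2 - ‖U.v x‖ ^ 2))
        = -(Δt * (W.ρ x * inner ℝ (gradient W.τ x) (W.v x)
          - W.μ x * inner ℝ (gradient W.φ x) (W.v x) - inner ℝ (D x) (W.v x))) := by
      have h1 : Δt * (1 / Δt) = 1 := mul_one_div_cancel hΔt.ne'
      linear_combination (-Δt) * hmomv
        - W.ρ x * (1 / 2 * (‖V.v x‖ ^ 2 - ‖U.v x‖ ^ 2)) * h1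
    have hρm : W.ρ x = (V.ρ x + U.ρ x) / 2 := rfl
    rw [divergence_smul (hδφ.differentiableAt ho hxΩ) (hs.differentiableAt ho hxΩ), hΔσ,
      divergence_smul (hτ.differentiableAt ho hxΩ) (hρv.differentiableAt ho hxΩ), map_smul,
      smul_eq_mul, ← inner_gradient, sq_abs]
    simp only [energyDensity]
    rw [hρm] at hmom' hphase ⊢
    linear_combination hE + W.μ x * hphase + W.τ x * hmass + hmom'
  have hEU := hU.integrableOn_energyDensity (γ := γ) ho hb hF
  have hEV := hV.integrableOn_energyDensity (γ := γ) ho hb hFV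
  have hdi := hdiss.integrableOn ho hb
  have hfi := hfrob.integrableOn ho hb
  refine ⟨hFV, hfi.add hdi, ?_⟩
  have hs₁ : IntegrableOn (fun x => η * (|W.μ x| ^ 2 / W.ρ x)
      + divergence (fun x => W.τ x • (W.ρ x • W.v x)) x) Ω := hdi.add hi₂
  have hs₂ : IntegrableOn (fun x => η * (|W.μ x| ^ 2 / W.ρ x)
      + divergence (fun x => W.τ x • (W.ρ x • W.v x)) x - inner ℝ (D x) (W.v x)) Ω := hs₁.sub hDvi
  have h1 := integral_congr_ae hpt
  rw [integral_sub hEV hEU, integral_sub (hi₁.const_mul _) (hs₂.const_mul _),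
    integral_const_mul, integral_const_mul, integral_sub hs₁ hDvi,
    integral_add hdi hi₂, hI₁, hI₂, hstress] at h1
  have h2 : ∫ x in Ω, dissipationDensity S η W x
      = (∫ x in Ω, frob (S (W.φ x) (jacobian W.v x)) (jacobian W.v x))
        + ∫ x in Ω, η * (|W.μ x| ^ 2 / W.ρ x) := integral_add hfi hdi
  rw [h2]
  linear_combination h1

end OneStep

end NSAC

/-! ### Summation over the time steps -/

theorem mainTheorem3 {d : ℕ} (hd : 1 ≤ d) {Ω : Set (NSAC.E d)} (hΩ : NSAC.IsAdmissibleDomain Ω)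
    (f : ℝ → ℝ → ℝ)
    (S : ℝ → Matrix (Fin d) (Fin d) ℝ → Matrix (Fin d) (Fin d) ℝ)
    (hS : Continuous fun p : ℝ × Matrix (Fin d) (Fin d) ℝ => S p.1 p.2)
    (γ η : ℝ) (N : ℕ) (t : ℕ → ℝ) (U : ℕ → NSAC.Fields d)
    (hU : NSAC.IsTimeDiscreteSolution Ω f S γ η N t U)
    (hinit : IntegrableOn (fun x => (U 0).ρ x * f ((U 0).ρ x) ((U 0).φ x)) Ω) :
    ∀ n ≤ N,
      IntegrableOn (NSAC.energyDensity f γ (U n)) Ω ∧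
      (∀ j < n, IntegrableOn (NSAC.dissipationDensity S η ((U j).mid (U (j + 1)))) Ω) ∧
      ∫ x in Ω, NSAC.energyDensity f γ (U n) x =
        (∫ x in Ω, NSAC.energyDensity f γ (U 0) x)
          - ∑ j ∈ Finset.range n, (t (j + 1) - t j) *
              ∫ x in Ω, NSAC.dissipationDensity S η ((U j).mid (U (j + 1))) x := by
  have hσ : ∀ n ≤ N, ∀ x ∈ Ω, (U n).σ x = gradient (U n).φ x := by
    rintro (_ | n) hn x hx
    · exact hU.initial_σ x hx
    · exact sub_eq_zero.1 ((hU.step n hn).gradient_eq x hx).symm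
  -- The induction carries integrability of `ρ f(ρ, φ)` alone, which is what one step consumes and
  -- returns; the other energy terms are bounded.
  have main : ∀ n ≤ N,
      IntegrableOn (fun x => (U n).ρ x * f ((U n).ρ x) ((U n).φ x)) Ω ∧
      (∀ j < n, IntegrableOn (NSAC.dissipationDensity S η ((U j).mid (U (j + 1)))) Ω) ∧
      ∫ x in Ω, NSAC.energyDensity f γ (U n) x =
        (∫ x in Ω, NSAC.energyDensity f γ (U 0) x)
          - ∑ j ∈ Finset.range n, (t (j + 1) - t j) *
              ∫ x in Ω, NSAC.dissipationDensity S η ((U j).mid (U (j + 1))) x := by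
    intro n
    induction n with
    | zero => exact fun _ => ⟨hinit, by simp, by simp⟩
    | succ n ih =>
      intro hn
      obtain ⟨hF, hdiss, heq⟩ := ih (Nat.le_of_succ_le hn)
      obtain ⟨h1, h2, h3⟩ := (hU.step n hn).energy_balance hd hΩ hS
        (sub_pos.2 (hU.time_lt n hn)) (hU.admissible n (Nat.le_of_succ_le hn))
        (hU.admissible (n + 1) hn) (hσ n (Nat.le_of_succ_le hn)) hF
      refine ⟨h1, fun j hj => ?_, ?_⟩
      · rcases Nat.lt_succ_iff_lt_or_eq.1 hj with hj | rfl
        · exact hdiss j hj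
        · exact h2
      · rw [h3, heq, Finset.sum_range_succ]
        ring
  intro n hn
  obtain ⟨hF, hdiss, heq⟩ := main n hn
  exact ⟨(hU.admissible n hn).integrableOn_energyDensity hΩ.isOpen hΩ.isBounded hF, hdiss, heq⟩
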